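/- Conventions. For a scheme $X$, closed subschemes correspond to quasi-coherent ideals; $V(\mathcal M_1)+V(\mathcal M_2)=V(\mathcal M_1\mathcal M_2)$ and $V(\mathcal M_1)\cap V(\mathcal M_2)=V(\mathcal M_1+\mathcal M_2)$. A closed subscheme is locally principal (resp. a Cartier divisor) if its ideal is locally generated by one element (resp. by one non-zero-divisor). If $Y_i, D_i$ ($i$ in a finite set) are closed subschemes of $X$ with the $D_i$ locally principal, $\mathrm{Bl}\{{}^{D_i}_{Y_i}\}_{i}X$ denotes the multi-centered dilatation: the affine $X$-scheme which, over an affine open $\mathrm{Spec}\,A$ where $Y_i=V(M_i)$ and $D_i=V(a_i)$, is the spectrum of the ring of fractions $m/a^{\nu}$ with $m\in\prod_i (M_i+(a_i))^{\nu_i}$, a subring of the localization $A[1/\prod_i a_i]$. For a finite totally ordered set $I$ and families $(Y_i)_{i\in I}$, $(D_i)_{i\in I}$ of closed subschemes of $X$ with all $D_i$ locally principal, put $$\mathbb D\big(({}^{D_i}_{Y_i})_{i\in I}\,{}_X\big)=\mathrm{Bl}\Big\{{}^{\sum_{j\ge i}D_j}_{Y_i}\Big\}_{i\in I}X .$$ If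 $X'\to X$ is a morphism and the $Y_i$ are closed subschemes of $X'$, then in $\mathbb D(({}^{D_i}_{Y_i})_{i}\,{}_{X'})$ the $D_i$ are replaced by their inverse images in $X'$. **Statement.** Let $X$ be a scheme, $I$ a finite totally ordered set, $(X_i)_{i\in I}$ closed subschemes of $X$ with $X_i\subset X_{i'}$ whenever $i\ge i'$, and $(D_i)_{i\in I}$ locally principal closed subschemes of $X$ such that $X_i\cap D_j$ is a Cartier divisor in $X_i$ for all $i,j\in I$. Let $S\subset I$ and $K=I\setminus S$ (with the induced orders), and assume that $k>s$ for all $k\in K$, $s\in S$. Write $P=\mathbb D(({}^{D_s}_{X_s})_{s\in S}\,{}_X)$. Then: 1. For every $k\in K$ there is a unique $X$-morphism $F(k,S):\mathbb D(({}^{D_s}_{X_s\cap X_k})_{s\in S}\,{}_{X_k})\to P$. It is a closed immersion, by which its source is identified with a closed subscheme of $P$, and these closed subschemes are decreasing in $k$. 2. There is a unique $X$-morphism $$\Theta(S):\ \mathbb D\Big(\big({}^{D_k}_{\mathbb D(({}^{D_s}_{X_s\cap X_k})_{s\in S}\,{}_{X_k})}\big)_{k\in K}\,{}_{P}\Big)\longrightarrow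 \mathbb D\big(({}^{D_i}_{X_i})_{i\in I}\,{}_X\big),$$ and it is an isomorphism. 3. For every $k\in K$ the dilatation map $\mathbb D(({}^{D_s}_{X_s\cap X_k})_{s\in S}\,{}_{X_k})\to X_k$ is an isomorphism, and there is a unique $X$-morphism $X_k\to P$; it is a closed immersion, its composite with the dilatation map is $F(k,S)$, and it defines the same closed subscheme of $P$ as $F(k,S)$. Identifying $X_k$ with this closed subscheme of $P$, there is a unique $X$-morphism $$\mathbb D\Big(({}^{D_k}_{X_k})_{k\in K}\,{}_{\mathbb D(({}^{D_s}_{X_s})_{s\in S}\,{}_X)}\Big)\longrightarrow \mathbb D\big(({}^{D_i}_{X_i})_{i\in I}\,{}_X\big),$$ and it is an isomorphism; it is $\Theta(S)$ in reformulated form. -/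

import Mathlib

open CategoryTheory AlgebraicGeometry

universe u v

noncomputable section

namespace MultiCenter

section Ring

variable {ι : Type v} [Fintype ι] {A B A' B' : Type u} [CommRing A] [CommRing B]
  [CommRing A'] [CommRing B']

/-- The dilatation of the ring `A` with multi-center `{[M i, J i]}`, realised in an `A`-algebra
`f : A → B` in which the ideals `J i` become invertible. With `L i = M i + J i` it consists of the
`x` such that, for some exponent `ν`, every `c ∈ J ^ ν` multiplies `x` into the image of `L ^ ν`.
If `J i = (a i)` and `B` is the localization of `A` at the `a i`, these are exactly the fractions
`m / a ^ ν` with `m ∈ L ^ ν`, i.e. the ring `A[{M i / a i}]`; see `mem_dilatationRing_span` (and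
`isLocalization_centerCompl` for the `B` used below). No choice of generators is made, so that the
definition makes sense on every affine open, also where the `J i` are only locally principal. -/
def dilatationRing (f : A →+* B) (M J : ι → Ideal A) : Subring B where
  carrier := {x | ∃ ν : ι → ℕ, ∀ c ∈ ∏ i, J i ^ ν i,
    ∃ m ∈ ∏ i, (M i ⊔ J i) ^ ν i, f c * x = f m}
  mul_mem' := by
    rintro x y ⟨ν, hx⟩ ⟨μ, hy⟩
    refine ⟨ν + μ, fun c hc ↦ ?_⟩
    simp only [Pi.add_apply, pow_add, Finset.prod_mul_distrib] at hc ⊢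
    refine Submodule.mul_induction_on hc (fun a ha b hb ↦ ?_) ?_
    · obtain ⟨m, hm, e⟩ := hx a ha
      obtain ⟨n, hn, e'⟩ := hy b hb
      exact ⟨m * n, Ideal.mul_mem_mul hm hn, by rw [map_mul, map_mul, ← e, ← e']; ring⟩
    · rintro a b ⟨m, hm, e⟩ ⟨n, hn, e'⟩
      exact ⟨m + n, add_mem hm hn, by rw [map_add, map_add, ← e, ← e']; ring⟩
  add_mem' := by
    rintro x y ⟨ν, hx⟩ ⟨μ, hy⟩
    have hle (κ : ι → ℕ) : ∏ i, J i ^ κ i ≤ ∏ i, (M i ⊔ J i) ^ κ i :=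
      Finset.prod_le_prod' fun i _ ↦ Ideal.pow_right_mono le_sup_right _
    refine ⟨ν + μ, fun c hc ↦ ?_⟩
    simp only [Pi.add_apply, pow_add, Finset.prod_mul_distrib] at hc ⊢
    refine Submodule.mul_induction_on hc (fun a ha b hb ↦ ?_) ?_
    · obtain ⟨m, hm, e⟩ := hx a ha
      obtain ⟨n, hn, e'⟩ := hy b hb
      refine ⟨m * b + a * n, add_mem (Ideal.mul_mem_mul hm (hle _ hb))
        (Ideal.mul_mem_mul (hle _ ha) hn), ?_⟩
      rw [map_mul, map_add, map_mul, map_mul, ← e, ← e']; ring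
    · rintro a b ⟨m, hm, e⟩ ⟨n, hn, e'⟩
      exact ⟨m + n, add_mem hm hn, by rw [map_add, map_add, ← e, ← e']; ring⟩
  neg_mem' := by
    rintro x ⟨ν, hx⟩
    refine ⟨ν, fun c hc ↦ ?_⟩
    obtain ⟨m, hm, e⟩ := hx c hc
    exact ⟨-m, neg_mem hm, by rw [map_neg, ← e]; ring⟩
  zero_mem' := ⟨0, fun c _ ↦ ⟨0, zero_mem _, by simp⟩⟩
  one_mem' := ⟨0, fun c hc ↦ ⟨c, by simp [-Ideal.one_eq_top], by simp⟩⟩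

lemma mem_dilatationRing {f : A →+* B} {M J : ι → Ideal A} {x : B} :
    x ∈ dilatationRing f M J ↔ ∃ ν : ι → ℕ, ∀ c ∈ ∏ i, J i ^ ν i,
      ∃ m ∈ ∏ i, (M i ⊔ J i) ^ ν i, f c * x = f m := Iff.rfl

/-- If `J i = (a i)`, the elements are the fractions `m / a ^ ν` with `m ∈ L ^ ν`. -/
lemma mem_dilatationRing_span (f : A →+* B) (M : ι → Ideal A) (a : ι → A) (x : B) :
    x ∈ dilatationRing f M (fun i ↦ Ideal.span {a i}) ↔ ∃ ν : ι → ℕ,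
      ∃ m ∈ ∏ i, (M i ⊔ Ideal.span {a i}) ^ ν i, f (∏ i, a i ^ ν i) * x = f m := by
  simp only [mem_dilatationRing, Ideal.span_singleton_pow, Ideal.prod_span_singleton]
  refine exists_congr fun ν ↦ ⟨fun h ↦ h _ (Ideal.mem_span_singleton_self _), ?_⟩
  rintro ⟨m, hm, e⟩ c hc
  obtain ⟨b, rfl⟩ := Ideal.mem_span_singleton'.mp hc
  exact ⟨b * m, Ideal.mul_mem_left _ _ hm, by rw [map_mul, map_mul, ← e]; ring⟩

lemma algebraMap_mem_dilatationRing (f : A →+* B) (M J : ι → Ideal A) (a : A) :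
    f a ∈ dilatationRing f M J :=
  ⟨0, fun c _ ↦ ⟨c * a, by simp [-Ideal.one_eq_top], by simp⟩⟩

lemma map_prod_pow (h : A →+* A') (J : ι → Ideal A) (ν : ι → ℕ) :
    (∏ i, J i ^ ν i).map h = ∏ i, (J i).map h ^ ν i := by
  simp only [← Ideal.map_pow]
  exact map_prod (Ideal.mapHom h) (fun i ↦ J i ^ ν i) Finset.univ

lemma map_mem_dilatationRing {f : A →+* B} {f' : A' →+* B'} {h : A →+* A'} {g : B →+* B'}
    (H : g.comp f = f'.comp h) {M J : ι → Ideal A} {M' J' : ι → Ideal A'}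
    (hM : ∀ i, (M i).map h = M' i) (hJ : ∀ i, (J i).map h = J' i) {x : B}
    (hx : x ∈ dilatationRing f M J) : g x ∈ dilatationRing f' M' J' := by
  obtain rfl : (fun i ↦ (M i).map h) = M' := funext hM
  obtain rfl : (fun i ↦ (J i).map h) = J' := funext hJ
  have H' (a : A) : f' (h a) = g (f a) := congr($H a).symm
  obtain ⟨ν, hν⟩ := hx
  refine ⟨ν, fun c hc ↦ ?_⟩
  simp only [← Ideal.map_sup, ← map_prod_pow] at hc ⊢
  refine Submodule.span_induction ?_ ⟨0, zero_mem _, by simp⟩ ?_ ?_ hc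
  · rintro _ ⟨a, ha, rfl⟩
    obtain ⟨m, hm, e⟩ := hν a ha
    exact ⟨h m, Ideal.mem_map_of_mem _ hm, by rw [H', H', ← map_mul, e]⟩
  · rintro a b _ _ ⟨m, hm, e⟩ ⟨n, hn, e'⟩
    exact ⟨m + n, add_mem hm hn, by rw [map_add, map_add, ← e, ← e']; ring⟩
  · rintro a b _ ⟨m, hm, e⟩
    exact ⟨a * m, Ideal.mul_mem_left _ _ hm, by rw [smul_eq_mul, map_mul, map_mul, ← e]; ring⟩

lemma isLocalization_dilatationRing {f : A →+* B} {f' : A' →+* B'} {h : A →+* A'} {g : B →+* B'}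
    (H : g.comp f = f'.comp h) {M J : ι → Ideal A} {M' J' : ι → Ideal A'}
    (hM : ∀ i, (M i).map h = M' i) (hJ : ∀ i, (J i).map h = J' i) (hfg : ∀ i, (J i).FG) (r : A)
    (h₁ : letI := h.toAlgebra; IsLocalization.Away r A')
    (h₂ : letI := g.toAlgebra; IsLocalization.Away (f r) B')
    (φ : dilatationRing f M J →+* dilatationRing f' M' J') (hφ : ∀ x, (φ x : B') = g x)
    (r' : dilatationRing f M J) (hr' : (r' : B) = f r) :
    letI := φ.toAlgebra; IsLocalization.Away r' (dilatationRing f' M' J') := by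
  obtain rfl : (fun i ↦ (M i).map h) = M' := funext hM
  obtain rfl : (fun i ↦ (J i).map h) = J' := funext hJ
  have H' (a : A) : f' (h a) = g (f a) := congr($H a).symm
  let _ := h.toAlgebra
  let _ := g.toAlgebra
  let _ := φ.toAlgebra
  have key (N : Ideal A) (m' : A') (hm' : m' ∈ N.map h) :
      ∃ m ∈ N, ∃ n, h (r ^ n) * m' = h m := by
    obtain ⟨⟨m, s⟩, e⟩ := (IsLocalization.mem_map_algebraMap_iff (.powers r) A').mp hm'
    obtain ⟨_, n, rfl⟩ := s
    exact ⟨m, m.2, n, by rw [mul_comm]; exact e⟩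
  have eqB (b c : B) (e : g b = g c) : ∃ n, f r ^ n * b = f r ^ n * c := by
    obtain ⟨⟨_, n, rfl⟩, e⟩ := (IsLocalization.eq_iff_exists (.powers (f r)) B').mp e
    exact ⟨n, e⟩
  have hunit : IsUnit (h r) := IsLocalization.Away.algebraMap_isUnit r
  refine ⟨⟨?_, ?_, ?_⟩⟩
  · rintro ⟨_, n, rfl⟩
    rw [map_pow]
    refine IsUnit.pow _ ?_
    obtain ⟨u, hu⟩ := hunit.exists_right_inv
    refine IsUnit.of_mul_eq_one ⟨f' u, algebraMap_mem_dilatationRing _ _ _ _⟩ ?_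
    ext
    change (φ r' : B') * f' u = 1
    rw [hφ, hr', ← H', ← map_mul, hu, map_one]
  · rintro ⟨y, ν, hν⟩
    obtain ⟨⟨b, _, n, rfl⟩, e⟩ := IsLocalization.surj (.powers (f r)) y
    change y * g (f r ^ n) = g b at e
    have hfgν : (∏ i, J i ^ ν i).FG := by
      refine Finset.prod_induction _ (fun N : Ideal A ↦ N.FG) (fun _ _ h h' ↦ h.mul h') ?_
        fun i _ ↦ (hfg i).pow
      rw [Ideal.one_eq_top]
      exact ⟨{1}, by simp⟩
    obtain ⟨t, ht⟩ := hfgν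
    have hc (c : A) : c ∈ ∏ i, J i ^ ν i → ∃ N, ∀ k ≥ N, ∃ m ∈ ∏ i, (M i ⊔ J i) ^ ν i,
        f c * (f r ^ k * b) = f m := by
      intro hc
      obtain ⟨m', hm', e'⟩ := hν (h c) (by
        simp only [← map_prod_pow]; exact Ideal.mem_map_of_mem _ hc)
      simp only [← Ideal.map_sup, ← map_prod_pow] at hm'
      obtain ⟨m, hm, p, e''⟩ := key _ m' hm'
      have : g (f r ^ p * (f c * b)) = g (f r ^ n * f m) := by
        rw [map_mul, map_mul, ← e, map_mul, ← H' m, ← e'', map_mul, ← e', H', H', map_pow f]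
        ring
      obtain ⟨q, hq⟩ := eqB _ _ this
      refine ⟨q + p, fun k hk ↦ ?_⟩
      obtain ⟨k, rfl⟩ := Nat.exists_eq_add_of_le hk
      refine ⟨r ^ k * (r ^ q * (r ^ n * m)), Ideal.mul_mem_left _ _ (Ideal.mul_mem_left _ _
        (Ideal.mul_mem_left _ _ hm)), ?_⟩
      rw [map_mul f (r ^ k), map_mul f (r ^ q), map_mul f (r ^ n), map_pow, map_pow, map_pow, ← hq]
      ring
    choose! N hN using hc
    let K := t.sup N
    have hb : f r ^ K * b ∈ dilatationRing f M J := by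
      refine ⟨ν, fun c hc ↦ ?_⟩
      rw [← ht] at hc
      refine Submodule.span_induction ?_ ⟨0, zero_mem _, by simp⟩ ?_ ?_ hc
      · intro a ha
        exact hN a (ht ▸ Ideal.subset_span ha) K (Finset.le_sup ha)
      · rintro a b _ _ ⟨m, hm, e⟩ ⟨n, hn, e'⟩
        exact ⟨m + n, add_mem hm hn, by rw [map_add, map_add, ← e, ← e']; ring⟩
      · rintro a b _ ⟨m, hm, e⟩
        exact ⟨a * m, Ideal.mul_mem_left _ _ hm,
          by rw [smul_eq_mul, map_mul, map_mul, ← e]; ring⟩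
    refine ⟨⟨⟨_, hb⟩, ⟨r' ^ (K + n), K + n, rfl⟩⟩, ?_⟩
    ext
    change y * (φ (r' ^ (K + n)) : B') = φ ⟨_, hb⟩
    rw [hφ, hφ, Subring.coe_pow, hr', map_mul, ← e, ← map_pow, ← map_pow]
    simp only [map_pow]
    ring
  · intro x y e
    have e' : g x = g y := by rw [← hφ, ← hφ]; exact congr(($e : B'))
    obtain ⟨n, hn⟩ := eqB _ _ e'
    refine ⟨⟨r' ^ n, n, rfl⟩, ?_⟩
    ext
    change ((r' ^ n : dilatationRing f M J) : B) * x = (r' ^ n : dilatationRing f M J) * y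
    rw [Subring.coe_pow, hr', hn]

end Ring
section Scheme

variable {X X' : Scheme.{u}}

/-- The closed subscheme with ideal sheaf `J` is locally principal: locally `J` is generated by one
element. (Closed subschemes of `X` are represented by their quasi-coherent ideal sheaves, so that
inclusion of closed subschemes is reversed, the sum of closed subschemes is the product of ideal
sheaves, and the inverse image is `comap`.) -/
def IsLocallyPrincipal (J : X.IdealSheafData) : Prop :=
  ∀ x : X, ∃ U : X.affineOpens, x ∈ U.1 ∧ ∃ a : Γ(X, U.1), J.ideal U = Ideal.span {a}

/-- The closed subscheme with ideal sheaf `J` is an (effective) Cartier divisor: locally `J` is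
generated by one non-zero-divisor. -/
def IsCartier (J : X.IdealSheafData) : Prop :=
  ∀ x : X, ∃ U : X.affineOpens, x ∈ U.1 ∧
    ∃ a ∈ nonZeroDivisors Γ(X, U.1), J.ideal U = Ideal.span {a}

lemma exists_principal_le {J : X.IdealSheafData} {U V : X.affineOpens} (hUV : U ≤ V)
    (h : ∃ a : Γ(X, V.1), J.ideal V = Ideal.span {a}) :
    ∃ a : Γ(X, U.1), J.ideal U = Ideal.span {a} := by
  obtain ⟨a, ha⟩ := h
  exact ⟨_, by rw [← J.map_ideal hUV, ha, Ideal.map_span, Set.image_singleton]⟩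

lemma exists_affine_le (x : X) (V : X.Opens) (hx : x ∈ V) :
    ∃ U : X.affineOpens, x ∈ U.1 ∧ U.1 ≤ V := by
  obtain ⟨_, ⟨U, hU, rfl⟩, hxU, hUV⟩ := X.isBasis_affineOpens.exists_subset_of_mem_open hx V.2
  exact ⟨⟨U, hU⟩, hxU, hUV⟩

lemma IsLocallyPrincipal.mul {J₁ J₂ : X.IdealSheafData} (h₁ : IsLocallyPrincipal J₁)
    (h₂ : IsLocallyPrincipal J₂) : IsLocallyPrincipal (J₁ * J₂) := by
  intro x
  obtain ⟨U₁, hx₁, h₁⟩ := h₁ x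
  obtain ⟨U₂, hx₂, h₂⟩ := h₂ x
  obtain ⟨U, hxU, hU⟩ := exists_affine_le x (U₁.1 ⊓ U₂.1) ⟨hx₁, hx₂⟩
  obtain ⟨a, ha⟩ := exists_principal_le (U := U) (hU.trans inf_le_left) h₁
  obtain ⟨b, hb⟩ := exists_principal_le (U := U) (hU.trans inf_le_right) h₂
  refine ⟨U, hxU, a * b, ?_⟩
  rw [Scheme.IdealSheafData.ideal_mul, Pi.mul_apply, ha, hb, Ideal.span_singleton_mul_span_singleton]

lemma IsLocallyPrincipal.one : IsLocallyPrincipal (1 : X.IdealSheafData) := fun x ↦ by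
  obtain ⟨U, hxU, -⟩ := exists_affine_le x ⊤ trivial
  exact ⟨U, hxU, 1, by simp⟩

lemma IsLocallyPrincipal.prod {ι : Type v} (s : Finset ι) {J : ι → X.IdealSheafData}
    (h : ∀ i, IsLocallyPrincipal (J i)) : IsLocallyPrincipal (∏ i ∈ s, J i) :=
  Finset.prod_induction _ _ (fun _ _ ↦ .mul) .one fun i _ ↦ h i

lemma ideal_comap_of_isAffine {X Y : Scheme.{u}} [IsAffine X] [IsAffine Y] (f : X ⟶ Y)
    (J : Y.IdealSheafData) :
    (J.comap f).ideal ⟨⊤, isAffineOpen_top X⟩ =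
      (J.ideal ⟨⊤, isAffineOpen_top Y⟩).map f.appTop.hom := by
  apply le_antisymm
  · let K : X.IdealSheafData := .ofIdealTop ((J.ideal ⟨⊤, isAffineOpen_top Y⟩).map f.appTop.hom)
    have hK : K.ideal ⟨⊤, isAffineOpen_top X⟩ =
      (J.ideal ⟨⊤, isAffineOpen_top Y⟩).map f.appTop.hom :=
        Scheme.IdealSheafData.equivOfIsAffine.apply_symm_apply _
    rw [← hK]
    suffices J.comap f ≤ K from this _
    rw [← Scheme.IdealSheafData.le_map_iff_comap_le]
    apply Scheme.IdealSheafData.le_of_isAffine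
    rw [Scheme.IdealSheafData.ideal_map_of_isAffineHom, ← Ideal.map_le_iff_le_comap]
    exact hK.ge
  · rw [Ideal.map_le_iff_le_comap]
    have := J.le_map_comap f ⟨⊤, isAffineOpen_top Y⟩
    rwa [Scheme.IdealSheafData.ideal_map_of_isAffineHom] at this

lemma exists_principal_comap_iff {U X : Scheme.{u}} (j : U ⟶ X) [IsOpenImmersion j]
    (J : X.IdealSheafData) (W : U.affineOpens) :
    (∃ a, (J.comap j).ideal W = Ideal.span {a}) ↔
      ∃ a, J.ideal ⟨j ''ᵁ W, W.2.image_of_isOpenImmersion j⟩ = Ideal.span {a} := by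
  rw [Scheme.IdealSheafData.ideal_comap_of_isOpenImmersion]
  let e := (j.appIso W).commRingCatIsoToRingEquiv
  change (∃ a, Ideal.comap e.symm (J.ideal ⟨j ''ᵁ W, _⟩) = Ideal.span {a}) ↔ _
  rw [Ideal.comap_symm]
  constructor
  · rintro ⟨a, ha⟩
    refine ⟨e.symm a, ?_⟩
    have := congr(Ideal.map e.symm $ha)
    rw [Ideal.map_span, Set.image_singleton] at this
    exact (Ideal.map_of_equiv e).symm.trans this
  · rintro ⟨a, ha⟩
    exact ⟨e a, by rw [ha, Ideal.map_span, Set.image_singleton]⟩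

lemma exists_principal_comap_ι_iff (J : X.IdealSheafData) (U : X.affineOpens) :
    (∃ a, (J.comap U.1.ι).ideal ⟨⊤, @isAffineOpen_top _ U.2⟩ = Ideal.span {a}) ↔
      ∃ a, J.ideal U = Ideal.span {a} := by
  rw [exists_principal_comap_iff]
  have : (⟨U.1.ι ''ᵁ ⊤, (@isAffineOpen_top _ U.2).image_of_isOpenImmersion U.1.ι⟩ :
    X.affineOpens) = U := Subtype.ext (by simp)
  rw [this]

lemma IsLocallyPrincipal.comap {J : X.IdealSheafData} (h : IsLocallyPrincipal J) (f : X' ⟶ X) :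
    IsLocallyPrincipal (J.comap f) := by
  intro x
  obtain ⟨V, hxV, hV⟩ := h (f x)
  obtain ⟨U, hxU, hUV⟩ := exists_affine_le x (f ⁻¹ᵁ V.1) hxV
  have : IsAffine U.1 := U.2
  have : IsAffine V.1 := V.2
  refine ⟨U, hxU, ?_⟩
  rw [← exists_principal_comap_ι_iff] at hV ⊢
  obtain ⟨a, ha⟩ := hV
  rw [← Scheme.IdealSheafData.comap_comp, ← Scheme.Hom.resLE_comp_ι f hUV,
    Scheme.IdealSheafData.comap_comp, ideal_comap_of_isAffine, ha, Ideal.map_span,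
    Set.image_singleton]
  exact ⟨_, rfl⟩

lemma ideal_prod {ι : Type v} (s : Finset ι) (J : ι → X.IdealSheafData) (U : X.affineOpens) :
    (∏ i ∈ s, J i).ideal U = ∏ i ∈ s, (J i).ideal U := by
  classical
  induction s using Finset.induction_on with
  | empty => simp
  | insert a s ha ih => simp [Finset.prod_insert ha, ih]

lemma IsLocallyPrincipal.fg {J : X.IdealSheafData} (h : IsLocallyPrincipal J)
    (U : X.affineOpens) : (J.ideal U).FG := by
  let s : Set Γ(X, U.1) := {r | ((J.ideal (X.affineBasicOpen r))).FG}
  have hs : Ideal.span s = ⊤ := by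
    rw [← U.2.self_le_iSup_basicOpen_iff]
    intro x hx
    obtain ⟨V, hxV, hV⟩ := h x
    obtain ⟨r, q, e, hxr⟩ := exists_basicOpen_le_affine_inter U.2 V.2 x ⟨hx, hxV⟩
    obtain ⟨a, ha⟩ := exists_principal_le (U := X.affineBasicOpen r) (V := V)
      (e.trans_le (X.basicOpen_le q)) hV
    refine TopologicalSpace.Opens.mem_iSup.mpr ⟨⟨r, ?_⟩, hxr⟩
    exact ⟨{a}, by simpa using ha.symm⟩
  have (r : s) : IsLocalization.Away r.1 Γ(X, X.basicOpen r.1) :=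
    U.2.isLocalization_basicOpen r.1
  refine Submodule.of_localizationSpan' s hs (Rₚ := fun r ↦ Γ(X, X.basicOpen r.1))
    (fun r ↦ Algebra.linearMap Γ(X, U.1) Γ(X, X.basicOpen r.1)) fun r ↦ ?_
  rw [Ideal.localized'_eq_map]
  have := J.map_ideal_basicOpen U r.1
  exact this ▸ r.2

variable {ι : Type v} [Fintype ι]

/-- The open complement `X ∖ ⋃ i, V(J i)` (the support of a product is the union of the supports). -/
def centerCompl (J : ι → X.IdealSheafData) : X.Opens := (∏ i, J i).support.compl

/-- Restriction of sections. -/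
def res {U V : X.Opens} (h : U ≤ V) : Γ(X, V) →+* Γ(X, U) := (X.presheaf.map (homOfLE h).op).hom

lemma res_comp_res {U V W : X.Opens} (h : U ≤ V) (h' : V ≤ W) :
    (res h).comp (res h') = res (h.trans h') := by
  rw [res, res, ← CommRingCat.hom_comp, ← Functor.map_comp]; rfl

lemma isLocalization_res {U V : X.Opens} (h : V ≤ U) (f : Γ(X, U)) (hV : V = X.basicOpen f)
    (hU : IsCompact U.1) (hU' : IsQuasiSeparated U.1) :
    letI := (res h).toAlgebra; IsLocalization.Away f Γ(X, V) := by
  subst hV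
  exact isLocalization_basicOpen_of_qcqs hU hU' f

/-- The sections over the affine open `U` of the dilatation algebra with multi-center
`{[V(M i), V(J i)]}`, inside the ring of functions on `U ∖ ⋃ i, V(J i)`. -/
def dilatationSections (M J : ι → X.IdealSheafData) (U : X.affineOpens) :
    Subring Γ(X, U.1 ⊓ centerCompl J) :=
  dilatationRing (res inf_le_left) (fun i ↦ (M i).ideal U) (fun i ↦ (J i).ideal U)

lemma res_mem_dilatationSections (M J : ι → X.IdealSheafData) {U V : X.affineOpens} (h : U ≤ V)
    (x : Γ(X, V.1 ⊓ centerCompl J)) (hx : x ∈ dilatationSections M J V) :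
    res (inf_le_inf_right (centerCompl J) h) x ∈ dilatationSections M J U :=
  map_mem_dilatationRing (f := res inf_le_left) (f' := res inf_le_left) (h := res h)
    (g := res (inf_le_inf_right (centerCompl J) h))
    (by rw [res_comp_res, res_comp_res])
    (fun i ↦ (M i).map_ideal h) (fun i ↦ (J i).map_ideal h) hx

/-- The restriction maps of the dilatation algebra. -/
def dilatationRes (M J : ι → X.IdealSheafData) {U V : X.affineOpens} (h : U ≤ V) :
    dilatationSections M J V →+* dilatationSections M J U :=
  (res (inf_le_inf_right (centerCompl J) h)).restrict _ _ (res_mem_dilatationSections M J h)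

/-- The dilatation algebra as a presheaf of rings on the affine opens of `X`. -/
def dilatationDiagram (M J : ι → X.IdealSheafData) : X.AffineZariskiSiteᵒᵖ ⥤ CommRingCat.{u} where
  obj U := .of (dilatationSections M J ⟨U.unop.1, U.unop.2⟩)
  map i := CommRingCat.ofHom (dilatationRes M J
    (Scheme.AffineZariskiSite.toOpens_mono (leOfHom i.unop)))
  map_id U := by
    ext x
    exact congr($(X.presheaf.map_id _) x.1)
  map_comp i j := by
    ext x
    exact congr($(X.presheaf.map_comp (homOfLE (inf_le_inf_right (centerCompl J)
      (Scheme.AffineZariskiSite.toOpens_mono (leOfHom i.unop)))).op (homOfLE (inf_le_inf_right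
      (centerCompl J) (Scheme.AffineZariskiSite.toOpens_mono (leOfHom j.unop)))).op) x.1)

/-- The structure map from `𝒪_X` to the dilatation algebra. -/
def dilatationDiagramMap (M J : ι → X.IdealSheafData) :
    (Scheme.AffineZariskiSite.toOpensFunctor X).op ⋙ X.presheaf ⟶ dilatationDiagram M J where
  app U := CommRingCat.ofHom ((res inf_le_left).codRestrict
    (dilatationSections M J ⟨U.unop.1, U.unop.2⟩) (algebraMap_mem_dilatationRing _ _ _))
  naturality U V i := by
    ext x
    refine Subtype.ext ?_
    have h : V.unop.1 ≤ U.unop.1 := Scheme.AffineZariskiSite.toOpens_mono (leOfHom i.unop)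
    have := (res_comp_res (inf_le_left (b := centerCompl J)) h).trans
      (res_comp_res (inf_le_inf_right (centerCompl J) h) inf_le_left).symm
    exact congr($this x)

lemma inf_centerCompl (J : ι → X.IdealSheafData) (U : X.affineOpens) (t : Finset Γ(X, U.1))
    (ht : (∏ i, J i).ideal U = Ideal.span t) :
    U.1 ⊓ centerCompl J = ⨆ c ∈ t, X.basicOpen c := by
  ext x
  have h := Scheme.IdealSheafData.supportSet_inter (∏ i, J i) U
  rw [ht, Scheme.zeroLocus_span] at h
  have hx := congr(x ∈ $h)
  have hx' : x ∈ (∏ i, J i).supportSet ∩ U.1 ↔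
    x ∈ X.zeroLocus (U := U.1) (t : Set Γ(X, U.1)) ∩ U.1 := iff_of_eq hx
  simp only [Set.mem_inter_iff, Scheme.mem_zeroLocus_iff, Finset.mem_coe] at hx'
  simp only [TopologicalSpace.Opens.coe_iSup, Set.mem_iUnion, exists_prop]
  have hle (c : Γ(X, U.1)) (h : x ∈ X.basicOpen c) : x ∈ U.1 := X.basicOpen_le c h
  have hW : x ∈ centerCompl J ↔ x ∉ (∏ i, J i).supportSet := Iff.rfl
  change (x ∈ U.1 ∧ x ∈ centerCompl J) ↔ ∃ c, c ∈ t ∧ x ∈ X.basicOpen c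
  rw [hW]
  constructor
  · rintro ⟨h₁, h₂⟩
    by_contra! H
    exact h₂ (hx'.mpr ⟨H, h₁⟩).1
  · rintro ⟨c, hc, hxc⟩
    exact ⟨hle c hxc, fun h ↦ (hx'.mp ⟨h, hle c hxc⟩).1 c hc hxc⟩

/-- On an affine open `U` where `J i = (a i)`, the functions on `U ∖ ⋃ i, V(J i)` are the
localization of the functions on `U` at `∏ i, a i`. -/
lemma isLocalization_centerCompl (J : ι → X.IdealSheafData) (U : X.affineOpens)
    (a : ι → Γ(X, U.1)) (ha : ∀ i, (J i).ideal U = Ideal.span {a i}) :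
    letI := (res (inf_le_left : U.1 ⊓ centerCompl J ≤ U.1)).toAlgebra
    IsLocalization.Away (∏ i, a i) Γ(X, U.1 ⊓ centerCompl J) := by
  refine isLocalization_res _ _ ?_ U.2.isCompact U.2.isQuasiSeparated
  rw [inf_centerCompl J U {∏ i, a i}]
  · simp
  · simp [ideal_prod, ha, Ideal.prod_span_singleton]

/-- The dilatation algebra is quasi-coherent: its formation commutes with passing from an affine open
`U` to a principal open `D(r) ⊆ U`. -/
lemma coequifibered_dilatationDiagramMap (M : ι → X.IdealSheafData) {J : ι → X.IdealSheafData}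
    (hJ : ∀ i, IsLocallyPrincipal (J i)) : (dilatationDiagramMap M J).Coequifibered := by
  refine Scheme.AffineZariskiSite.coequifibered_iff_forall_isLocalizationAway.mpr fun U r ↦ ?_
  have hfg : ((∏ i, J i).ideal ⟨U.1, U.2⟩).FG :=
    (IsLocallyPrincipal.prod Finset.univ hJ).fg ⟨U.1, U.2⟩
  have hc : IsCompact (U.1 ⊓ centerCompl J).1 := by
    obtain ⟨t, ht⟩ := hfg
    rw [inf_centerCompl J ⟨U.1, U.2⟩ t ht.symm]
    simp only [TopologicalSpace.Opens.carrier_eq_coe, TopologicalSpace.Opens.coe_iSup]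
    exact t.isCompact_biUnion fun c _ ↦ (U.2.basicOpen c).isCompact
  have hqs : IsQuasiSeparated (U.1 ⊓ centerCompl J).1 :=
    U.2.isQuasiSeparated.of_subset inf_le_left
  refine isLocalization_dilatationRing (h := res (X.basicOpen_le r))
    (f := res inf_le_left) (f' := res inf_le_left)
    (g := res (inf_le_inf_right (centerCompl J) (X.basicOpen_le r)))
    ?_ (fun i ↦ (M i).map_ideal_basicOpen ⟨U.1, U.2⟩ r)
    (fun i ↦ (J i).map_ideal_basicOpen ⟨U.1, U.2⟩ r) (fun i ↦ (hJ i).fg ⟨U.1, U.2⟩) r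
    (U.2.isLocalization_basicOpen r) ?_
    (dilatationRes M J (U := ⟨_, (U.basicOpen r).2⟩) (V := ⟨U.1, U.2⟩) (X.basicOpen_le r)) (fun _ ↦ rfl)
    ⟨res inf_le_left r, algebraMap_mem_dilatationRing _ _ _ _⟩ rfl
  · rw [res_comp_res, res_comp_res]
  · refine isLocalization_res _ _ ?_ hc hqs
    rw [res, Scheme.basicOpen_res]
    apply le_antisymm
    · exact le_inf (inf_le_inf_right _ (X.basicOpen_le r)) inf_le_left
    · exact le_inf inf_le_right (inf_le_left.trans inf_le_right)

/-- The relative spectrum data of the dilatation algebra. -/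
def dilatationGluing (M : ι → X.IdealSheafData) {J : ι → X.IdealSheafData}
    (hJ : ∀ i, IsLocallyPrincipal (J i)) :=
  Scheme.AffineZariskiSite.relativeGluingData (coequifibered_dilatationDiagramMap M hJ)

/-- The dilatation `Bl {[V(M i), V(J i)]} X` of the scheme `X` with multi-center
`{[V(M i), V(J i)]}`, where the `V(J i)` are locally principal: the relative spectrum over `X` of
the dilatation algebra. -/
def dilatation (M : ι → X.IdealSheafData) (J : ι → X.IdealSheafData)
    (hJ : ∀ i, IsLocallyPrincipal (J i)) : Scheme.{u} := (dilatationGluing M hJ).glued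

/-- The dilatation map, an affine morphism to `X`. -/
def dilatationMap (M : ι → X.IdealSheafData) (J : ι → X.IdealSheafData)
    (hJ : ∀ i, IsLocallyPrincipal (J i)) : dilatation M J hJ ⟶ X := (dilatationGluing M hJ).toBase


section Deformation

variable {I : Type v} [LinearOrder I] [Fintype I]

/-- The deformation space `𝔻((D i over Y i)_{i ∈ I}, X)`: the dilatation of `X` with multi-center
`{[Y i, ∑_{j ≥ i} D j]}`. -/
def deformationSpace (Y D : I → X.IdealSheafData) (hD : ∀ i, IsLocallyPrincipal (D i)) :
    Scheme.{u} :=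
  dilatation Y (fun i ↦ ∏ j with i ≤ j, D j) fun _ ↦ .prod _ hD

/-- The dilatation map from the deformation space to `X`. -/
def deformationMap (Y D : I → X.IdealSheafData) (hD : ∀ i, IsLocallyPrincipal (D i)) :
    deformationSpace Y D hD ⟶ X :=
  dilatationMap Y (fun i ↦ ∏ j with i ≤ j, D j) fun _ ↦ .prod _ hD

/-- `𝔻((D s over Y s)_{s ∈ S}, X)` for a subset `S` of the index set. -/
abbrev partialSpace (Y D : I → X.IdealSheafData) (hD : ∀ i, IsLocallyPrincipal (D i))
    (S : Finset I) : Scheme.{u} :=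
  deformationSpace (fun s : S ↦ Y s) (fun s : S ↦ D s) fun s ↦ hD s

/-- The dilatation map `𝔻((D s over Y s)_{s ∈ S}, X) ⟶ X`. -/
abbrev partialMap (Y D : I → X.IdealSheafData) (hD : ∀ i, IsLocallyPrincipal (D i))
    (S : Finset I) : partialSpace Y D hD S ⟶ X :=
  deformationMap (fun s : S ↦ Y s) (fun s : S ↦ D s) fun s ↦ hD s

/-- `𝔻((D s over Y s ∩ Y k)_{s ∈ S}, Y k)`, with the `D s` pulled back to `Y k`. -/
abbrev centerSpace (Y D : I → X.IdealSheafData) (hD : ∀ i, IsLocallyPrincipal (D i))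
    (S : Finset I) (k : I) : Scheme.{u} :=
  partialSpace (X := (Y k).subscheme) (fun i ↦ (Y i).comap (Y k).subschemeι)
    (fun i ↦ (D i).comap (Y k).subschemeι) (fun i ↦ (hD i).comap _) S

/-- The dilatation map `𝔻((D s over Y s ∩ Y k)_{s ∈ S}, Y k) ⟶ Y k`. -/
abbrev centerMap (Y D : I → X.IdealSheafData) (hD : ∀ i, IsLocallyPrincipal (D i))
    (S : Finset I) (k : I) : centerSpace Y D hD S k ⟶ (Y k).subscheme :=
  partialMap (X := (Y k).subscheme) (fun i ↦ (Y i).comap (Y k).subschemeι)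
    (fun i ↦ (D i).comap (Y k).subschemeι) (fun i ↦ (hD i).comap _) S

/-- `𝔻((D k over Z k)_{k ∉ S}, P)` where `P = 𝔻((D s over Y s)_{s ∈ S}, X)`, the `Z k` are closed
subschemes of `P` and the `D k` are pulled back to `P`. -/
abbrev iteratedSpace (Y D : I → X.IdealSheafData) (hD : ∀ i, IsLocallyPrincipal (D i))
    (S : Finset I) (Z : ↥Sᶜ → (partialSpace Y D hD S).IdealSheafData) : Scheme.{u} :=
  deformationSpace Z (fun k ↦ (D k).comap (partialMap Y D hD S)) fun k ↦ (hD k).comap _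

/-- The structure morphism of `iteratedSpace` over `X` (the composite of the two dilatation maps). -/
abbrev iteratedMap (Y D : I → X.IdealSheafData) (hD : ∀ i, IsLocallyPrincipal (D i))
    (S : Finset I) (Z : ↥Sᶜ → (partialSpace Y D hD S).IdealSheafData) :
    iteratedSpace Y D hD S Z ⟶ X :=
  deformationMap Z (fun k ↦ (D k).comap (partialMap Y D hD S)) (fun k ↦ (hD k).comap _) ≫
    partialMap Y D hD S

end Deformation

end Scheme

end MultiCenter

end

open MultiCenter

noncomputable section

namespace MultiCenter

/-! ### Inverse images of ideal sheaves; Cartier and locally principal ideals -/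

section IdealSheaf

variable {X X' : Scheme.{u}}

/-! Everything is deduced from the universal property of dilatations (`exists_dilatation_lift`,
`dilatation_hom_ext`): a morphism `f : T ⟶ X` under which every `J i` becomes Cartier lifts,
uniquely, as soon as `M i` pulls back into the pullback of `J i`. It is proved on charts, where the
dilatation is the spectrum of a ring of fractions `m / a ^ ν`; `IsRingDilatation` records what is
needed about that ring.

Let `P` be the partial deformation space. For `k ∈ K = Sᶜ` and `s ∈ S` the ideal `Y s` vanishes on
the subscheme `Y k`, where all `D j` are Cartier. So dilating `Y k` changes nothing, and its
inclusion lifts uniquely to a section `σ k` into `P`. This section is a closed immersion because `P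
⟶ X` is affine.

For `Θ`, the pullback of `Y i` to the iterated space must lie in `∏ j ≥ i, D j`. If `i ∈ K`, this
holds because `Y i` pulls back into the ideal of `σ i`. If `i ∈ S`, the ideal `Y i` on `P` is
contained in the `S`-part of the product and also vanishes on each `σ k`. Since the `D j` are
Cartier on `Y k`, the divisor can be cancelled, which leaves an extra factor `(σ k).ker`
(`le_mul_ker`). With `k` the least element of `K`, that factor yields the whole `K`-part.

For the inverse, the full deformation space maps to `P`, and the ideal of `σ k` must pull back into
`∏ j ≥ k, D j`. The ideal of `σ k` is not generated by `Y k` alone, since it also contains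
fractions. `ker_comap_le` controls it by splitting each numerator into a part already divisible by
the denominator with quotient in the target ideal, and a multiple of the denominator by an element
of `Y k`. Uniqueness then shows that the two maps are mutually inverse. -/

lemma ideal_comap_ι_top (J : X.IdealSheafData) (U : X.affineOpens) :
    (J.comap U.1.ι).ideal ⟨⊤, @isAffineOpen_top _ U.2⟩ = (J.ideal U).map U.1.topIso.inv.hom := by
  rw [Scheme.IdealSheafData.ideal_comap_of_isOpenImmersion]
  have hU : (⟨U.1.ι ''ᵁ ⊤, (@isAffineOpen_top _ U.2).image_of_isOpenImmersion U.1.ι⟩ :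
    X.affineOpens) ≤ U := by
    change U.1.ι ''ᵁ ⊤ ≤ U.1
    simp
  rw [← J.map_ideal hU]
  have h : (U.1.ι.appIso ⊤).inv = 𝟙 _ := by simp; rfl
  rw [h]
  exact Ideal.comap_id _

/-- The inverse image of an ideal sheaf along `f` is computed by the comorphisms of `f`. -/
lemma ideal_comap_eq_map_appLE (f : X' ⟶ X) (J : X.IdealSheafData) {U : X.affineOpens}
    {W : X'.affineOpens} (h : W.1 ≤ f ⁻¹ᵁ U.1) :
    (J.comap f).ideal W = (J.ideal U).map (f.appLE U.1 W.1 h).hom := by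
  have : IsAffine U.1 := U.2
  have : IsAffine W.1 := W.2
  have e : (J.comap f).comap W.1.ι = (J.comap U.1.ι).comap (f.resLE U.1 W.1 h) := by
    rw [← Scheme.IdealSheafData.comap_comp, ← Scheme.IdealSheafData.comap_comp,
      Scheme.Hom.resLE_comp_ι]
  have e' : ((J.comap f).ideal W).map W.1.topIso.inv.hom =
      ((J.ideal U).map U.1.topIso.inv.hom).map (f.resLE U.1 W.1 h).appTop.hom := by
    rw [← ideal_comap_ι_top, ← ideal_comap_ι_top, e, ideal_comap_of_isAffine]
  have e'' := congr(Ideal.map W.1.topIso.hom.hom $e')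
  rw [Ideal.map_map, Ideal.map_map, Ideal.map_map, ← CommRingCat.hom_comp, ← CommRingCat.hom_comp,
    ← CommRingCat.hom_comp, Scheme.Hom.appTop, Scheme.Hom.resLE_app_top] at e''
  simp only [Iso.inv_hom_id, Category.assoc, Iso.inv_hom_id_assoc, Category.comp_id] at e''
  rw [← e'']
  exact (Ideal.map_id _).symm

lemma exists_affine_le_preimage (f : X' ⟶ X) (x : X') (W : X'.Opens) (hx : x ∈ W) (U : X.Opens)
    (hU : f x ∈ U) : ∃ V : X'.affineOpens, x ∈ V.1 ∧ V.1 ≤ W ∧ V.1 ≤ f ⁻¹ᵁ U := by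
  obtain ⟨V, hxV, hV⟩ := exists_affine_le x (W ⊓ f ⁻¹ᵁ U) ⟨hx, hU⟩
  exact ⟨V, hxV, hV.trans inf_le_left, hV.trans inf_le_right⟩

lemma idealSheaf_le_of_local {I J : X.IdealSheafData}
    (h : ∀ x : X, ∃ U : X.affineOpens, x ∈ U.1 ∧ I.ideal U ≤ J.ideal U) : I ≤ J := by
  choose U hx hU using h
  exact Scheme.IdealSheafData.le_of_iSup_eq_top U
    (top_le_iff.mp fun x _ ↦ TopologicalSpace.Opens.mem_iSup.mpr ⟨x, hx x⟩) hU

lemma exists_affine_of_hom (f : X' ⟶ X) (x : X') :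
    ∃ (U : X.affineOpens) (W : X'.affineOpens), x ∈ W.1 ∧ W.1 ≤ f ⁻¹ᵁ U.1 := by
  obtain ⟨U, hU, -⟩ := exists_affine_le (f x) ⊤ trivial
  obtain ⟨W, hW, -, hWU⟩ := exists_affine_le_preimage f x ⊤ trivial U.1 hU
  exact ⟨U, W, hW, hWU⟩

/-- Equality of ideal sheaves is local, and over affine charts pullback is extension of ideals,
which respects products. -/
lemma comap_mul (f : X' ⟶ X) (I J : X.IdealSheafData) :
    (I * J).comap f = I.comap f * J.comap f := by
  have key (x : X') : ∃ W : X'.affineOpens, x ∈ W.1 ∧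
      ((I * J).comap f).ideal W = (I.comap f * J.comap f).ideal W := by
    obtain ⟨U, W, hx, h⟩ := exists_affine_of_hom f x
    refine ⟨W, hx, ?_⟩
    simp only [Scheme.IdealSheafData.ideal_mul, Pi.mul_apply, ideal_comap_eq_map_appLE f _ h,
      Ideal.map_mul]
  apply le_antisymm
  · exact idealSheaf_le_of_local fun x ↦ (key x).imp fun W h ↦ ⟨h.1, h.2.le⟩
  · exact idealSheaf_le_of_local fun x ↦ (key x).imp fun W h ↦ ⟨h.1, h.2.ge⟩

lemma comap_prod {ι : Type v} (f : X' ⟶ X) (s : Finset ι) (J : ι → X.IdealSheafData) :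
    (∏ i ∈ s, J i).comap f = ∏ i ∈ s, (J i).comap f := by
  classical
  induction s using Finset.induction_on with
  | empty =>
    simp only [Finset.prod_empty]
    exact Scheme.IdealSheafData.comap_top f
  | insert a s ha ih => rw [Finset.prod_insert ha, Finset.prod_insert ha, comap_mul, ih]

lemma flat_map_mem_nonZeroDivisors {R S : Type*} [CommRing R] [CommRing S] {f : R →+* S}
    (hf : f.Flat) {a : R} (ha : a ∈ nonZeroDivisors R) : f a ∈ nonZeroDivisors S := by
  algebraize [f]
  have h := Module.Flat.isSMulRegular_of_nonZeroDivisors (M := S) ha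
  rw [mem_nonZeroDivisors_iff_right]
  intro x hx
  refine h (?_ : a • x = a • 0)
  rw [smul_zero, Algebra.smul_def, mul_comm]
  exact hx

lemma res_mem_nonZeroDivisors {U V : X.affineOpens} (h : U.1 ≤ V.1) {a : Γ(X, V.1)}
    (ha : a ∈ nonZeroDivisors Γ(X, V.1)) : res h a ∈ nonZeroDivisors Γ(X, U.1) := by
  -- Restriction between affine opens is a comorphism of the flat morphism `𝟙 X`, hence flat.
  have hf := Scheme.Hom.flat_appLE (𝟙 X) V.2 U.2 h
  have e : (𝟙 X : X ⟶ X).appLE V.1 U.1 h = X.presheaf.map (homOfLE h).op := by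
    simp only [Scheme.Hom.appLE, Scheme.Hom.id_app]
    exact Category.id_comp _
  rw [e] at hf
  exact flat_map_mem_nonZeroDivisors hf ha

lemma ideal_eq_span_res {J : X.IdealSheafData} {U V : X.affineOpens} (h : U.1 ≤ V.1)
    {a : Γ(X, V.1)} (ha : J.ideal V = Ideal.span {a}) : J.ideal U = Ideal.span {res h a} := by
  rw [← J.map_ideal (U := U) (V := V) h, ha, Ideal.map_span, Set.image_singleton]
  rfl

lemma mem_nonZeroDivisors_of_span_eq {R : Type*} [CommRing R] {a b : R}
    (h : Ideal.span {a} = Ideal.span {b}) (hb : b ∈ nonZeroDivisors R) :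
    a ∈ nonZeroDivisors R := by
  obtain ⟨c, hc⟩ := Ideal.mem_span_singleton'.mp (h ▸ Ideal.mem_span_singleton_self b :
    b ∈ Ideal.span {a})
  exact (mul_mem_nonZeroDivisors.mp (hc ▸ hb)).2

lemma section_eq_zero_of_local {U : X.Opens} (s : Γ(X, U))
    (h : ∀ x ∈ U, ∃ (V : X.Opens) (hV : V ≤ U), x ∈ V ∧ res hV s = 0) : s = 0 := by
  refine TopCat.Presheaf.section_ext X.sheaf U s 0 fun x hx ↦ ?_
  obtain ⟨V, hV, hxV, e⟩ := h x hx
  change X.presheaf.germ U x hx s = X.presheaf.germ U x hx 0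
  rw [map_zero, ← X.presheaf.germ_res_apply (homOfLE hV) x hxV s]
  exact (congrArg _ e).trans (map_zero _)

/-- Frees the Cartier condition from the chosen chart and generator. Near each point `a` divides a
regular generator, so a section killed by `a` vanishes locally. -/
lemma IsCartier.mem_nonZeroDivisors {J : X.IdealSheafData} (hJ : IsCartier J) (W : X.affineOpens)
    {a : Γ(X, W.1)} (ha : J.ideal W = Ideal.span {a}) : a ∈ nonZeroDivisors Γ(X, W.1) := by
  rw [mem_nonZeroDivisors_iff_right]
  intro s hs
  refine section_eq_zero_of_local s fun x hx ↦ ?_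
  obtain ⟨U, hxU, b, hb, e⟩ := hJ x
  obtain ⟨V, hxV, hV⟩ := exists_affine_le x (W.1 ⊓ U.1) ⟨hx, hxU⟩
  refine ⟨V.1, hV.trans inf_le_left, hxV, ?_⟩
  have h := mem_nonZeroDivisors_of_span_eq
    ((ideal_eq_span_res (hV.trans inf_le_left) ha).symm.trans
      (ideal_eq_span_res (hV.trans inf_le_right) e))
    (res_mem_nonZeroDivisors (hV.trans inf_le_right) hb)
  rw [mem_nonZeroDivisors_iff_right] at h
  refine h _ ?_
  rw [← map_mul, hs, map_zero]

lemma IsCartier.isLocallyPrincipal {J : X.IdealSheafData} (hJ : IsCartier J) :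
    IsLocallyPrincipal J := fun x ↦ by
  obtain ⟨U, hxU, a, -, ha⟩ := hJ x
  exact ⟨U, hxU, a, ha⟩

lemma IsLocallyPrincipal.exists_le {J : X.IdealSheafData} (hJ : IsLocallyPrincipal J) (x : X)
    (V : X.Opens) (hx : x ∈ V) : ∃ U : X.affineOpens, x ∈ U.1 ∧ U.1 ≤ V ∧
      ∃ a, J.ideal U = Ideal.span {a} := by
  obtain ⟨W, hxW, a, ha⟩ := hJ x
  obtain ⟨U, hxU, hU⟩ := exists_affine_le x (V ⊓ W.1) ⟨hx, hxW⟩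
  exact ⟨U, hxU, hU.trans inf_le_left, _, ideal_eq_span_res (hU.trans inf_le_right) ha⟩

/-- Finiteness allows shrinking once per index; the resulting opens are the charts on which the
dilatation is a ring of fractions. -/
lemma exists_le_forall_principal {ι : Type v} [Finite ι] {J : ι → X.IdealSheafData}
    (hJ : ∀ i, IsLocallyPrincipal (J i)) (x : X) (V : X.Opens) (hx : x ∈ V) :
    ∃ U : X.affineOpens, x ∈ U.1 ∧ U.1 ≤ V ∧
      ∃ a : ι → Γ(X, U.1), ∀ i, (J i).ideal U = Ideal.span {a i} := by
  classical
  have := Fintype.ofFinite ι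
  have key (s : Finset ι) : ∃ U : X.affineOpens, x ∈ U.1 ∧ U.1 ≤ V ∧
      ∀ i ∈ s, ∃ a, (J i).ideal U = Ideal.span {a} := by
    induction s using Finset.induction_on with
    | empty =>
      obtain ⟨U, hxU, hU⟩ := exists_affine_le x V hx
      exact ⟨U, hxU, hU, by simp⟩
    | insert i s _ ih =>
      obtain ⟨U, hxU, hU, h⟩ := ih
      obtain ⟨W, hxW, hW, a, ha⟩ := (hJ i).exists_le x U.1 hxU
      refine ⟨W, hxW, hW.trans hU, fun j hj ↦ ?_⟩
      obtain rfl | hj := Finset.mem_insert.mp hj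
      · exact ⟨a, ha⟩
      · obtain ⟨b, hb⟩ := h j hj
        exact ⟨_, ideal_eq_span_res hW hb⟩
  obtain ⟨U, hxU, hU, h⟩ := key Finset.univ
  choose a ha using fun i ↦ h i (Finset.mem_univ i)
  exact ⟨U, hxU, hU, a, ha⟩

lemma ideal_comap_eq_span (f : X' ⟶ X) {J : X.IdealSheafData} {U : X.affineOpens}
    {W : X'.affineOpens} (h : W.1 ≤ f ⁻¹ᵁ U.1) {a : Γ(X, U.1)}
    (ha : J.ideal U = Ideal.span {a}) :
    (J.comap f).ideal W = Ideal.span {f.appLE U.1 W.1 h a} := by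
  rw [ideal_comap_eq_map_appLE f J h, ha, Ideal.map_span, Set.image_singleton]

lemma IsCartier.comap_of_flat {J : X.IdealSheafData} (hJ : IsCartier J) (f : X' ⟶ X) [Flat f] :
    IsCartier (J.comap f) := by
  intro x
  obtain ⟨U, hxU, a, ha, e⟩ := hJ (f x)
  obtain ⟨W, hxW, -, hW⟩ := exists_affine_le_preimage f x ⊤ trivial U.1 hxU
  exact ⟨W, hxW, _, flat_map_mem_nonZeroDivisors (f.flat_appLE U.2 W.2 hW) ha,
    ideal_comap_eq_span f hW e⟩

lemma IsCartier.mul {J K : X.IdealSheafData} (hJ : IsCartier J) (hK : IsCartier K) :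
    IsCartier (J * K) := by
  intro x
  obtain ⟨U, hxU, -, a, ha⟩ := hJ.isLocallyPrincipal.exists_le x ⊤ trivial
  obtain ⟨W, hxW, hW, b, hb⟩ := hK.isLocallyPrincipal.exists_le x U.1 hxU
  have ha' := ideal_eq_span_res hW ha
  refine ⟨W, hxW, _, mul_mem_nonZeroDivisors.mpr
    ⟨hJ.mem_nonZeroDivisors W ha', hK.mem_nonZeroDivisors W hb⟩, ?_⟩
  rw [Scheme.IdealSheafData.ideal_mul, Pi.mul_apply, ha', hb, Ideal.span_singleton_mul_span_singleton]

lemma IsCartier.one : IsCartier (1 : X.IdealSheafData) := fun x ↦ by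
  obtain ⟨U, hxU, -⟩ := exists_affine_le x ⊤ trivial
  exact ⟨U, hxU, 1, one_mem _, by simp⟩

lemma IsCartier.prod {ι : Type v} (s : Finset ι) {J : ι → X.IdealSheafData}
    (h : ∀ i ∈ s, IsCartier (J i)) : IsCartier (∏ i ∈ s, J i) :=
  Finset.prod_induction _ _ (fun _ _ ↦ .mul) .one h

/-- A factor of a non-zero-divisor is one. This recovers each `D i` from the product `∏ j ≥ i, D j`.
-/
lemma IsCartier.of_mul_left {J K : X.IdealSheafData} (h : IsCartier (J * K))
    (hJ : IsLocallyPrincipal J) (hK : IsLocallyPrincipal K) : IsCartier J := by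
  intro x
  obtain ⟨U, hxU, -, a, ha⟩ := hJ.exists_le x ⊤ trivial
  obtain ⟨W, hxW, hW, b, hb⟩ := hK.exists_le x U.1 hxU
  have ha' := ideal_eq_span_res hW ha
  refine ⟨W, hxW, _, (mul_mem_nonZeroDivisors.mp (h.mem_nonZeroDivisors W (a := _ * b) ?_)).1, ha'⟩
  rw [Scheme.IdealSheafData.ideal_mul, Pi.mul_apply, ha', hb, Ideal.span_singleton_mul_span_singleton]

end IdealSheaf

/-! ### Dilatations of rings and their universal property -/

section Ring

variable {ι : Type v} [Fintype ι]

/-- The ring map `ψ : A → R` is a dilatation of `A` with multi-center `{[M i, (a i)]}`. -/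
structure IsRingDilatation {A R : Type u} [CommRing A] [CommRing R] (ψ : A →+* R)
    (M : ι → Ideal A) (a : ι → A) : Prop where
  exists_fraction (x : R) : ∃ ν : ι → ℕ, ∃ m ∈ ∏ i, (M i ⊔ Ideal.span {a i}) ^ ν i,
    ψ (∏ i, a i ^ ν i) * x = ψ m
  map_mem_nonZeroDivisors (b : A) (hb : b ∈ nonZeroDivisors A) : ψ b ∈ nonZeroDivisors R
  gen_mem_nonZeroDivisors (i : ι) : ψ (a i) ∈ nonZeroDivisors R
  gen_dvd (i : ι) (m : A) (hm : m ∈ M i) : ψ (a i) ∣ ψ m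
  exists_lift (C : Type u) [CommRing C] (h : A →+* C) (ha : ∀ i, h (a i) ∈ nonZeroDivisors C)
    (hM : ∀ i, ∀ m ∈ M i, h (a i) ∣ h m) : ∃ g : R →+* C, g.comp ψ = h

variable {A B C R : Type u} [CommRing A] [CommRing B] [CommRing C] [CommRing R]

/-- Divisibility of the generators of the centers makes every fraction `m / a ^ ν` meaningful in
`C`. -/
lemma prod_pow_dvd_of_mem {M : ι → Ideal A} {a : ι → A} (h : A →+* C)
    (hM : ∀ i, ∀ m ∈ M i, h (a i) ∣ h m) (ν : ι → ℕ) (m : A)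
    (hm : m ∈ ∏ i, (M i ⊔ Ideal.span {a i}) ^ ν i) : h (∏ i, a i ^ ν i) ∣ h m := by
  have h₁ := Ideal.mem_map_of_mem h hm
  rw [map_prod_pow] at h₁
  have h₂ : ∏ i, (M i ⊔ Ideal.span {a i}).map h ^ ν i ≤ ∏ i, Ideal.span {h (a i)} ^ ν i := by
    refine Finset.prod_le_prod' fun i _ ↦ Ideal.pow_right_mono ?_ _
    rw [Ideal.map_sup, Ideal.map_span, Set.image_singleton]
    refine sup_le (Ideal.map_le_iff_le_comap.mpr fun m hm ↦ ?_) le_rfl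
    exact Ideal.mem_span_singleton.mpr (hM i m hm)
  have h₃ := h₂ h₁
  simp only [Ideal.span_singleton_pow, Ideal.prod_span_singleton] at h₃
  rw [map_prod]
  simpa only [map_pow] using Ideal.mem_span_singleton.mp h₃

/-- The dilatation ring is a subring of the localization `B`, which is flat over `A` and in which
the `a i` are units; this gives all regularity claims. -/
lemma isRingDilatation_dilatationRing (f : A →+* B) (M : ι → Ideal A) (J : ι → Ideal A)
    (a : ι → A) (hJ : ∀ i, J i = Ideal.span {a i})
    (hB : letI := f.toAlgebra; IsLocalization.Away (∏ i, a i) B) :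
    IsRingDilatation (f.codRestrict (dilatationRing f M J) (algebraMap_mem_dilatationRing f M J))
      M a := by
  obtain rfl : J = fun i ↦ Ideal.span {a i} := funext hJ
  let _ := f.toAlgebra
  have hunit : IsUnit (∏ i, f (a i)) := by
    rw [← map_prod]
    exact IsLocalization.Away.algebraMap_isUnit (S := B) (∏ i, a i)
  have hnzd (b : A) (hb : f b ∈ nonZeroDivisors B) :
      f.codRestrict (dilatationRing f M fun i ↦ Ideal.span {a i})
        (algebraMap_mem_dilatationRing f M _) b ∈ nonZeroDivisors (dilatationRing f M _) := by
    rw [mem_nonZeroDivisors_iff_right] at hb ⊢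
    exact fun x hx ↦ Subtype.ext (hb x congr(($hx : B)))
  refine ⟨fun x ↦ ?_, fun b hb ↦ hnzd b ?_, fun i ↦ hnzd _ ?_, fun i m hm ↦ ?_,
    fun C _ h ha hM ↦ ?_⟩
  · obtain ⟨ν, m, hm, e⟩ := (mem_dilatationRing_span f M a x).mp x.2
    exact ⟨ν, m, hm, Subtype.ext e⟩
  · have : Module.Flat A B := IsLocalization.flat B (.powers (∏ i, a i))
    exact flat_map_mem_nonZeroDivisors (f := f) this hb
  · exact (isUnit_of_dvd_unit (Finset.dvd_prod_of_mem (fun i ↦ f (a i)) (Finset.mem_univ i))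
      hunit).mem_nonZeroDivisors
  · classical
    have hu : IsUnit (f (a i)) :=
      isUnit_of_dvd_unit (Finset.dvd_prod_of_mem (fun i ↦ f (a i)) (Finset.mem_univ i)) hunit
    obtain ⟨u, hu⟩ := hu.exists_right_inv
    -- The quotient is the fraction `m / a i`, with exponent one at `i` and zero elsewhere.
    refine ⟨⟨u * f m, (mem_dilatationRing_span f M a _).mpr ⟨Pi.single i 1, m, ?_, ?_⟩⟩,
      Subtype.ext ?_⟩
    · rw [Finset.prod_eq_single i (fun j _ hj ↦ by simp [Pi.single_eq_of_ne hj]) (by simp)]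
      simpa using Ideal.mem_sup_left hm
    · rw [Finset.prod_eq_single i (fun j _ hj ↦ by simp [Pi.single_eq_of_ne hj]) (by simp)]
      rw [Pi.single_eq_same, pow_one, ← mul_assoc, hu, one_mul]
    · change f m = f (a i) * (u * f m)
      rw [← mul_assoc, hu, one_mul]
  -- `C` embeds in `C'` because the `h (a i)` are regular. The map from `B` to `C'` sends the
  -- dilatation ring into the image of `C`, by divisibility of the numerators.
  · let C' := Localization.Away (∏ i, h (a i))
    have hinj : Function.Injective (algebraMap C C') :=
      IsLocalization.injective C' (M := .powers (∏ i, h (a i)))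
        (Submonoid.powers_le.mpr (Submonoid.prod_mem _ fun i _ ↦ ha i))
    have hu : IsUnit ((algebraMap C C').comp h (∏ i, a i)) := by
      rw [RingHom.comp_apply, map_prod h]
      exact IsLocalization.Away.algebraMap_isUnit _
    let g₀ : B →+* C' := IsLocalization.Away.lift (∏ i, a i) hu
    have hg₀ (x : A) : g₀ (f x) = algebraMap C C' (h x) :=
      IsLocalization.Away.lift_eq (S := B) (∏ i, a i) hu x
    have hmem (x : dilatationRing f M fun i ↦ Ideal.span {a i}) :
        g₀ x ∈ (algebraMap C C').range := by
      obtain ⟨ν, m, hm, e⟩ := (mem_dilatationRing_span f M a x).mp x.2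
      obtain ⟨c, hc⟩ := prod_pow_dvd_of_mem h hM ν m hm
      have e' := congr(g₀ $e)
      rw [map_mul, hg₀, hg₀, hc, map_mul] at e'
      refine ⟨c, (IsUnit.mul_left_cancel ?_ e').symm⟩
      rw [map_prod, map_prod]
      refine IsUnit.prod_univ_iff.mpr fun i ↦ ?_
      rw [map_pow, map_pow]
      exact IsUnit.pow _ (isUnit_of_dvd_unit
        (map_dvd _ (Finset.dvd_prod_of_mem (fun i ↦ h (a i)) (Finset.mem_univ i)))
        (IsLocalization.Away.algebraMap_isUnit (S := C') (∏ i, h (a i))))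
    let e := RingEquiv.ofBijective (algebraMap C C').rangeRestrict
      ⟨fun x y hxy ↦ hinj (congrArg Subtype.val hxy), (algebraMap C C').rangeRestrict_surjective⟩
    refine ⟨e.symm.toRingHom.comp ((g₀.comp (Subring.subtype _)).codRestrict _ hmem), ?_⟩
    ext x
    change e.symm _ = h x
    rw [RingEquiv.symm_apply_eq]
    exact Subtype.ext (hg₀ x)

lemma IsRingDilatation.of_equiv {R' : Type u} [CommRing R'] {ψ : A →+* R} {M : ι → Ideal A}
    {a : ι → A} (hψ : IsRingDilatation ψ M a) (e : R' ≃+* R) {ψ' : A →+* R'}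
    (he : ∀ x, e (ψ' x) = ψ x) : IsRingDilatation ψ' M a := by
  have hnzd (x : R') (hx : e x ∈ nonZeroDivisors R) : x ∈ nonZeroDivisors R' := by
    rw [mem_nonZeroDivisors_iff_right] at hx ⊢
    intro y hy
    apply e.injective
    rw [map_zero]
    exact hx _ (by rw [← map_mul, hy, map_zero])
  refine ⟨fun x ↦ ?_, fun b hb ↦ hnzd _ ?_, fun i ↦ hnzd _ ?_, fun i m hm ↦ ?_,
    fun C _ h ha hM ↦ ?_⟩
  · obtain ⟨ν, m, hm, h⟩ := hψ.exists_fraction (e x)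
    exact ⟨ν, m, hm, e.injective (by rw [map_mul, he, he, h])⟩
  · rw [he]; exact hψ.map_mem_nonZeroDivisors b hb
  · rw [he]; exact hψ.gen_mem_nonZeroDivisors i
  · rw [← map_dvd_iff e, he, he]; exact hψ.gen_dvd i m hm
  · obtain ⟨g, hg⟩ := hψ.exists_lift C h ha hM
    refine ⟨g.comp e.toRingHom, ?_⟩
    ext x
    rw [← hg]
    exact congrArg g (he x)

/-- A fraction is determined by its numerator and denominator once the denominator acts injectively.
Regularity is needed only for `g`, since `g'` agrees with it on the image of `A`. -/
lemma IsRingDilatation.hom_ext {ψ : A →+* R} {M : ι → Ideal A} {a : ι → A}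
    (hψ : IsRingDilatation ψ M a) {g g' : R →+* C} (h : g.comp ψ = g'.comp ψ)
    (ha : ∀ i, g (ψ (a i)) ∈ nonZeroDivisors C) : g = g' := by
  have h' (x : A) : g (ψ x) = g' (ψ x) := congr($h x)
  ext x
  obtain ⟨ν, m, -, e⟩ := hψ.exists_fraction x
  have e₁ := congr(g $e)
  have e₂ := congr(g' $e)
  rw [map_mul] at e₁ e₂
  rw [← h', ← h', ← e₁] at e₂
  refine ((mul_cancel_left_mem_nonZeroDivisors ?_).mp e₂).symm
  rw [map_prod, map_prod]
  refine Submonoid.prod_mem _ fun i _ ↦ ?_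
  rw [map_pow, map_pow]
  exact pow_mem (ha i) _

end Ring

/-! ### Affine charts of the dilatation of a scheme -/

section Chart

variable {X : Scheme.{u}} {ι : Type v} [Fintype ι] (M J : ι → X.IdealSheafData)
  (hJ : ∀ i, IsLocallyPrincipal (J i))

/-- The structure map of the dilatation algebra over an affine open. -/
def dilatationStructure (U : X.affineOpens) : Γ(X, U.1) →+* dilatationSections M J U :=
  (res inf_le_left).codRestrict (dilatationSections M J U) (algebraMap_mem_dilatationRing _ _ _)

instance : ((dilatationGluing M hJ).functor ⋙ Scheme.forget).IsLocallyDirected :=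
  Scheme.Cover.RelativeGluingData.instIsLocallyDirectedI₀CompFunctorForgetOfIsThin ..

/-- The chart of the dilatation over an affine open. -/
def dilatationChart (U : X.affineOpens) :
    Spec (.of (dilatationSections M J U)) ⟶ dilatation M J hJ :=
  (dilatationGluing M hJ).cover.f ⟨U.1, U.2⟩

instance (U : X.affineOpens) : IsOpenImmersion (dilatationChart M J hJ U) :=
  (dilatationGluing M hJ).cover.map_prop _

lemma dilatationChart_dilatationMap (U : X.affineOpens) :
    dilatationChart M J hJ U ≫ dilatationMap M J hJ =
      Spec.map (CommRingCat.ofHom (dilatationStructure M J U)) ≫ U.2.fromSpec :=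
  Limits.colimit.ι_desc _ _

lemma opensRange_dilatationChart (U : X.affineOpens) :
    (dilatationChart M J hJ U).opensRange = dilatationMap M J hJ ⁻¹ᵁ U.1 := by
  have := (dilatationGluing M hJ).toBase_preimage_eq_opensRange_ι ⟨U.1, U.2⟩
  rw [show ((Scheme.AffineZariskiSite.directedCover X).f ⟨U.1, U.2⟩).opensRange = U.1 from
    U.1.opensRange_ι] at this
  exact this.symm

instance isAffineHom_dilatationMap : IsAffineHom (dilatationMap M J hJ) where
  isAffine_preimage U hU := by
    rw [← opensRange_dilatationChart M J hJ ⟨U, hU⟩]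
    exact isAffineOpen_opensRange _

lemma SpecMap_fromSpec_appLE {U : X.Opens} (hU : IsAffineOpen U) {R : CommRingCat.{u}}
    (α : Γ(X, U) ⟶ R) (hle : ⊤ ≤ (Spec.map α ≫ hU.fromSpec) ⁻¹ᵁ U) :
    (Spec.map α ≫ hU.fromSpec).appLE U ⊤ hle ≫ (Scheme.ΓSpecIso R).hom = α := by
  rw [Scheme.Hom.comp_appLE, hU.fromSpec_app_self, Category.assoc, Category.assoc]
  refine (congrArg ((Scheme.ΓSpecIso _).inv ≫ ·)
    (Scheme.Hom.map_appLE_assoc (Spec.map α) hle _ _)).trans ?_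
  have h := Scheme.Hom.appLE_eq_app (Spec.map α) (U := ⊤)
  change (Scheme.ΓSpecIso _).inv ≫ (Spec.map α).appLE ⊤ ((Spec.map α) ⁻¹ᵁ ⊤) le_rfl ≫ _ = _
  rw [h]
  change (Scheme.ΓSpecIso _).inv ≫ (Spec.map α).appTop ≫ _ = _
  rw [Scheme.ΓSpecIso_naturality, Iso.inv_hom_id_assoc]

/-- The chart over `U` is an open immersion onto the preimage of `U`, so the ring statement
transports along the isomorphism of sections. All later arguments access the dilatation through
this. -/
lemma isRingDilatation_app (U : X.affineOpens) (a : ι → Γ(X, U.1))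
    (ha : ∀ i, (J i).ideal U = Ideal.span {a i}) :
    IsRingDilatation ((dilatationMap M J hJ).app U.1).hom (fun i ↦ (M i).ideal U) a := by
  have h := isRingDilatation_dilatationRing (res inf_le_left) (fun i ↦ (M i).ideal U)
    (fun i ↦ (J i).ideal U) a ha (isLocalization_centerCompl J U a ha)
  let c := dilatationChart M J hJ U
  have hc : (dilatationMap M J hJ ⁻¹ᵁ U.1) = c.opensRange :=
    (opensRange_dilatationChart M J hJ U).symm
  have htop : (⊤ : (Spec (.of (dilatationSections M J U))).Opens) =
      c ⁻¹ᵁ (dilatationMap M J hJ ⁻¹ᵁ U.1) := by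
    rw [hc]; simp
  have : IsIso (c.app (dilatationMap M J hJ ⁻¹ᵁ U.1)) := c.isIso_app _ hc.le
  have : IsIso (c.appLE (dilatationMap M J hJ ⁻¹ᵁ U.1) ⊤ htop.le) := by
    rw [Scheme.Hom.appLE, Subsingleton.elim (homOfLE htop.le) (eqToHom htop)]
    infer_instance
  have e : (dilatationMap M J hJ).app U.1 ≫ c.appLE (dilatationMap M J hJ ⁻¹ᵁ U.1) ⊤ htop.le ≫
      (Scheme.ΓSpecIso _).hom = CommRingCat.ofHom (dilatationStructure M J U) := by
    have h₁ := Scheme.Hom.comp_appLE c (dilatationMap M J hJ) U.1 ⊤ htop.le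
    have h₂ (g) (hg : g = Spec.map (CommRingCat.ofHom (dilatationStructure M J U)) ≫ U.2.fromSpec)
        (hle : ⊤ ≤ g ⁻¹ᵁ U.1) : g.appLE U.1 ⊤ hle ≫ (Scheme.ΓSpecIso _).hom =
          CommRingCat.ofHom (dilatationStructure M J U) := by
      subst hg
      exact SpecMap_fromSpec_appLE U.2 _ hle
    rw [← Category.assoc]
    exact (congrArg (· ≫ (Scheme.ΓSpecIso _).hom) h₁.symm).trans
      (h₂ _ (dilatationChart_dilatationMap M J hJ U) _)
  exact h.of_equiv (asIso (c.appLE (dilatationMap M J hJ ⁻¹ᵁ U.1) ⊤ htop.le ≫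
      (Scheme.ΓSpecIso _).hom)).commRingCatIsoToRingEquiv fun x ↦ congr($e x)

end Chart

/-! ### Universal property of the dilatation of a scheme -/

section UniversalProperty

variable {X T : Scheme.{u}} {ι : Type v} [Fintype ι] {M J : ι → X.IdealSheafData}
  {hJ : ∀ i, IsLocallyPrincipal (J i)}

lemma IsCartier.comap_comp_of_flat {T' : Scheme.{u}} {K : X.IdealSheafData} {f : T ⟶ X}
    (h : IsCartier (K.comap f)) (j : T' ⟶ T) [Flat j] : IsCartier (K.comap (j ≫ f)) := by
  rw [Scheme.IdealSheafData.comap_comp]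
  exact h.comap_of_flat j

lemma ι_comp_eq_of_appLE_eq {Y : Scheme.{u}} {g g' : T ⟶ Y} {V : Y.Opens} (hV : IsAffineOpen V)
    {W : T.Opens} (hW : IsAffineOpen W) (h : W ≤ g ⁻¹ᵁ V) (h' : W ≤ g' ⁻¹ᵁ V)
    (e : g.appLE V W h = g'.appLE V W h') : W.ι ≫ g = W.ι ≫ g' := by
  have : hW.fromSpec ≫ g = hW.fromSpec ≫ g' := by
    rw [← IsAffineOpen.SpecMap_appLE_fromSpec g hV hW h, e, IsAffineOpen.SpecMap_appLE_fromSpec]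
  rwa [← hW.isoSpec_inv_ι, Category.assoc, Category.assoc, cancel_epi] at this

/-- Locally on `T` both morphisms land in the same affine chart, because they agree over `X`; there
`IsRingDilatation.hom_ext` applies. -/
lemma dilatation_hom_ext {g g' : T ⟶ dilatation M J hJ}
    (h : g ≫ dilatationMap M J hJ = g' ≫ dilatationMap M J hJ)
    (hC : ∀ i, IsCartier ((J i).comap (g ≫ dilatationMap M J hJ))) : g = g' := by
  refine Scheme.hom_ext_of_forall g g' fun x ↦ ?_
  obtain ⟨U, hxU, -, a, ha⟩ :=
    exists_le_forall_principal hJ ((g ≫ dilatationMap M J hJ) x) ⊤ trivial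
  obtain ⟨W, hxW, -, hW⟩ :=
    exists_affine_le_preimage (g ≫ dilatationMap M J hJ) x ⊤ trivial U.1 hxU
  have hW' : W.1 ≤ (g' ≫ dilatationMap M J hJ) ⁻¹ᵁ U.1 := h ▸ hW
  have hV : IsAffineOpen (dilatationMap M J hJ ⁻¹ᵁ U.1) := U.2.preimage _
  have e₁ := Scheme.Hom.comp_appLE g (dilatationMap M J hJ) U.1 W.1 hW
  have e₂ := Scheme.Hom.comp_appLE g' (dilatationMap M J hJ) U.1 W.1 hW'
  have e₃ : (g ≫ dilatationMap M J hJ).appLE U.1 W.1 hW =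
    (g' ≫ dilatationMap M J hJ).appLE U.1 W.1 hW' := by congr 1
  refine ⟨W.1, hxW, ι_comp_eq_of_appLE_eq hV W.2 hW hW' ?_⟩
  ext1
  refine (isRingDilatation_app M J hJ U a ha).hom_ext ?_ fun i ↦ ?_
  · exact congrArg CommRingCat.Hom.hom ((e₁.symm.trans e₃).trans e₂)
  · have := (hC i).mem_nonZeroDivisors W (ideal_comap_eq_span _ hW (ha i))
    rwa [e₁] at this

lemma exists_local_lift (f : T ⟶ X) (hC : ∀ i, IsCartier ((J i).comap f))
    (hM : ∀ i, (M i).comap f ≤ (J i).comap f) (x : T) :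
    ∃ (W : T.Opens) (_ : x ∈ W) (g : W.toScheme ⟶ dilatation M J hJ),
      g ≫ dilatationMap M J hJ = W.ι ≫ f := by
  obtain ⟨U, hxU, -, a, ha⟩ := exists_le_forall_principal hJ (f x) ⊤ trivial
  obtain ⟨W, hxW, -, hW⟩ := exists_affine_le_preimage f x ⊤ trivial U.1 hxU
  have hU : IsAffineOpen U.1 := U.2
  have hW' : IsAffineOpen W.1 := W.2
  have hV : IsAffineOpen (dilatationMap M J hJ ⁻¹ᵁ U.1) := hU.preimage _
  obtain ⟨γ, hγ⟩ := (isRingDilatation_app M J hJ U a ha).exists_lift Γ(T, W.1)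
    (f.appLE U.1 W.1 hW).hom
    (fun i ↦ (hC i).mem_nonZeroDivisors W (ideal_comap_eq_span f hW (ha i))) fun i m hm ↦ by
      rw [← Ideal.mem_span_singleton]
      erw [← ideal_comap_eq_span f hW (ha i)]
      refine hM i W ?_
      rw [ideal_comap_eq_map_appLE f _ hW]
      exact Ideal.mem_map_of_mem _ hm
  refine ⟨W.1, hxW, hW'.isoSpec.hom ≫ Spec.map (CommRingCat.ofHom γ) ≫ hV.fromSpec, ?_⟩
  have e : (dilatationMap M J hJ).appLE U.1 (dilatationMap M J hJ ⁻¹ᵁ U.1) le_rfl ≫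
      CommRingCat.ofHom γ = f.appLE U.1 W.1 hW := by
    rw [Scheme.Hom.appLE_eq_app]
    ext1
    exact hγ
  rw [Category.assoc, Category.assoc,
    ← IsAffineOpen.SpecMap_appLE_fromSpec (dilatationMap M J hJ) hU hV le_rfl,
    ← Spec.map_comp_assoc, e, IsAffineOpen.SpecMap_appLE_fromSpec f hU hW' hW,
    IsAffineOpen.isoSpec_hom_fromSpec_assoc]

/-- Local lifts agree on overlaps by uniqueness, which applies because Cartier ideals stay Cartier
on open subschemes. -/
lemma exists_lift_of_openCover (f : T ⟶ X) (hC : ∀ i, IsCartier ((J i).comap f))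
    (𝒰 : Scheme.OpenCover.{u} T) (g : ∀ x, 𝒰.X x ⟶ dilatation M J hJ)
    (hg : ∀ x, g x ≫ dilatationMap M J hJ = 𝒰.f x ≫ f) :
    ∃ g : T ⟶ dilatation M J hJ, g ≫ dilatationMap M J hJ = f := by
  refine ⟨𝒰.glueMorphisms g fun x y ↦ dilatation_hom_ext ?_ fun i ↦ ?_, ?_⟩
  · rw [Category.assoc, Category.assoc, hg x, hg y, Limits.pullback.condition_assoc]
  · rw [Category.assoc, hg x, ← Category.assoc]
    exact (hC i).comap_comp_of_flat _
  · refine 𝒰.hom_ext _ _ fun x ↦ ?_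
    rw [Scheme.Cover.ι_glueMorphisms_assoc, hg x]

/-- The universal property of the dilatation (existence). -/
lemma exists_dilatation_lift (f : T ⟶ X) (hC : ∀ i, IsCartier ((J i).comap f))
    (hM : ∀ i, (M i).comap f ≤ (J i).comap f) :
    ∃ g : T ⟶ dilatation M J hJ, g ≫ dilatationMap M J hJ = f := by
  choose W hxW g hg using exists_local_lift (hJ := hJ) f hC hM
  exact exists_lift_of_openCover f hC (T.openCoverOfIsOpenCover W
    (top_le_iff.mp fun x _ ↦ TopologicalSpace.Opens.mem_iSup.mpr ⟨x, hxW x⟩)) g hg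

lemma isCartier_comap_dilatationMap (i : ι) : IsCartier ((J i).comap (dilatationMap M J hJ)) := by
  intro x
  obtain ⟨U, hxU, -, a, ha⟩ :=
    exists_le_forall_principal hJ (dilatationMap M J hJ x) ⊤ trivial
  have hV : IsAffineOpen (dilatationMap M J hJ ⁻¹ᵁ U.1) := U.2.preimage _
  refine ⟨⟨_, hV⟩, hxU, _, (isRingDilatation_app M J hJ U a ha).gen_mem_nonZeroDivisors i, ?_⟩
  rw [← Scheme.Hom.appLE_eq_app]
  exact ideal_comap_eq_span _ _ (ha i)

/-- Non-zero-divisors stay regular in the dilatation ring. Needed so that the `D s` remain Cartier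
after the second dilatation. -/
lemma IsCartier.comap_dilatationMap {K : X.IdealSheafData} (hK : IsCartier K) :
    IsCartier (K.comap (dilatationMap M J hJ)) := by
  intro x
  obtain ⟨U, hxU, -, b, hb⟩ :=
    hK.isLocallyPrincipal.exists_le (dilatationMap M J hJ x) ⊤ trivial
  obtain ⟨U', hxU', hU', a, ha⟩ := exists_le_forall_principal hJ _ U.1 hxU
  have hb' := ideal_eq_span_res hU' hb
  have hV : IsAffineOpen (dilatationMap M J hJ ⁻¹ᵁ U'.1) := U'.2.preimage _
  refine ⟨⟨_, hV⟩, hxU', _, (isRingDilatation_app M J hJ U' a ha).map_mem_nonZeroDivisors _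
    (hK.mem_nonZeroDivisors U' hb'), ?_⟩
  rw [← Scheme.Hom.appLE_eq_app]
  exact ideal_comap_eq_span _ _ hb'

lemma comap_dilatationMap_le (i : ι) :
    (M i).comap (dilatationMap M J hJ) ≤ (J i).comap (dilatationMap M J hJ) := by
  refine idealSheaf_le_of_local fun x ↦ ?_
  obtain ⟨U, hxU, -, a, ha⟩ :=
    exists_le_forall_principal hJ (dilatationMap M J hJ x) ⊤ trivial
  have hV : IsAffineOpen (dilatationMap M J hJ ⁻¹ᵁ U.1) := U.2.preimage _
  refine ⟨⟨_, hV⟩, hxU, ?_⟩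
  have hle : (⟨_, hV⟩ : (dilatation M J hJ).affineOpens).1 ≤ dilatationMap M J hJ ⁻¹ᵁ U.1 := le_rfl
  rw [ideal_comap_eq_map_appLE _ _ hle, ideal_comap_eq_span _ hle (ha i),
    Ideal.map_le_iff_le_comap]
  intro m hm
  rw [Ideal.mem_comap, Ideal.mem_span_singleton, Scheme.Hom.appLE_eq_app]
  exact (isRingDilatation_app M J hJ U a ha).gen_dvd i m hm

end UniversalProperty

/-! ### Ideals of closed subschemes of a dilatation -/

section Kernel

/-- Expand `(n + c * α) * (n' + c' * β)`: the three terms containing `n` or `n'` stay in the first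
summand, and the last is a multiple of `α * β`. Multiplicativity passes the shape of a numerator
from the generators to `∏ i, L i ^ ν i`. -/
lemma mul_mem_numerators {A C : Type u} [CommRing A] [CommRing C] (τ : A →+* C) (N : Ideal A)
    (E : Ideal C) (α β : A) :
    (N ⊓ (Ideal.span {τ α} * E).comap τ ⊔ Ideal.span {α}) *
      (N ⊓ (Ideal.span {τ β} * E).comap τ ⊔ Ideal.span {β}) ≤
        N ⊓ (Ideal.span {τ (α * β)} * E).comap τ ⊔ Ideal.span {α * β} := by
  have h₁ (α β n c : A) (hn : n ∈ N ⊓ (Ideal.span {τ α} * E).comap τ) :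
      n * (c * β) ∈ N ⊓ (Ideal.span {τ (α * β)} * E).comap τ := by
    obtain ⟨hn, hn'⟩ := hn
    obtain ⟨e, he, h⟩ := Ideal.mem_span_singleton_mul.mp (Ideal.mem_comap.mp hn')
    refine ⟨N.mul_mem_right _ hn, Ideal.mem_comap.mpr (Ideal.mem_span_singleton_mul.mpr
      ⟨τ c * e, E.mul_mem_left _ he, ?_⟩)⟩
    rw [map_mul, map_mul, map_mul, ← h]
    ring
  refine Ideal.mul_le.mpr fun x hx y hy ↦ ?_
  obtain ⟨n, hn, _, hc, rfl⟩ := Submodule.mem_sup.mp hx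
  obtain ⟨n', hn', _, hc', rfl⟩ := Submodule.mem_sup.mp hy
  obtain ⟨c, rfl⟩ := Ideal.mem_span_singleton'.mp hc
  obtain ⟨c', rfl⟩ := Ideal.mem_span_singleton'.mp hc'
  refine Submodule.mem_sup.mpr ⟨n * n' + n * (c' * β) + n' * (c * α),
    add_mem (add_mem ?_ (h₁ α β n c' hn)) ?_, c * c' * (α * β),
    Ideal.mul_mem_left _ _ (Ideal.mem_span_singleton_self _), by ring⟩
  · refine ⟨N.mul_mem_right _ hn.1, Ideal.mem_comap.mpr ?_⟩
    obtain ⟨e, he, h⟩ := Ideal.mem_span_singleton_mul.mp (Ideal.mem_comap.mp hn.2)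
    obtain ⟨e', he', h'⟩ := Ideal.mem_span_singleton_mul.mp (Ideal.mem_comap.mp hn'.2)
    refine Ideal.mem_span_singleton_mul.mpr ⟨e * e', E.mul_mem_left _ he', ?_⟩
    rw [map_mul, map_mul, ← h, ← h']
    ring
  · rw [mul_comm α β]
    exact h₁ β α n' c hn'

lemma prod_pow_le_numerators {ι : Type v} [Fintype ι] {A C : Type u} [CommRing A] [CommRing C]
    (τ : A →+* C) (N : Ideal A) (E : Ideal C) (L : ι → Ideal A) (a : ι → A)
    (h : ∀ i, L i ≤ N ⊓ (Ideal.span {τ (a i)} * E).comap τ ⊔ Ideal.span {a i}) (ν : ι → ℕ) :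
    ∏ i, L i ^ ν i ≤ N ⊓ (Ideal.span {τ (∏ i, a i ^ ν i)} * E).comap τ ⊔
      Ideal.span {∏ i, a i ^ ν i} := by
  classical
  have hpow (i : ι) (n : ℕ) : L i ^ n ≤
      N ⊓ (Ideal.span {τ (a i ^ n)} * E).comap τ ⊔ Ideal.span {a i ^ n} := by
    induction n with
    | zero => simp
    | succ n ih =>
      rw [pow_succ, pow_succ]
      exact (Ideal.mul_mono ih (h i)).trans (mul_mem_numerators τ N E _ _)
  induction (Finset.univ : Finset ι) using Finset.induction_on with
  | empty => simp
  | insert i s hi ih =>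
    rw [Finset.prod_insert hi, Finset.prod_insert hi]
    exact (Ideal.mul_mono (hpow i _) ih).trans (mul_mem_numerators τ N E _ _)

/-- Write `x` in the kernel as `(n + c * a ^ ν) / a ^ ν`, where `n` dies under `s` and becomes `a ^
ν * d` in `C` with `d ∈ E`. Then `c` dies under `s` too, so `t x = d + t (ψ c)` lies in `E`. -/
lemma IsRingDilatation.ker_le_comap {ι : Type v} [Fintype ι] {A R Q C : Type u} [CommRing A]
    [CommRing R] [CommRing Q] [CommRing C] {ψ : A →+* R} {M : ι → Ideal A} {a : ι → A}
    (hψ : IsRingDilatation ψ M a) (s : R →+* Q) (t : R →+* C) (E : Ideal C)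
    (hM : ∀ i, M i ≤ RingHom.ker (s.comp ψ)) (ha : ∀ i, s (ψ (a i)) ∈ nonZeroDivisors Q)
    (hE : RingHom.ker (s.comp ψ) ≤ E.comap (t.comp ψ))
    (hME : ∀ i, M i ≤ (Ideal.span {t (ψ (a i))} * E).comap (t.comp ψ))
    (ha' : ∀ i, t (ψ (a i)) ∈ nonZeroDivisors C) : RingHom.ker s ≤ E.comap t := by
  intro x hx
  have hx : s x = 0 := hx
  obtain ⟨ν, m, hm, e⟩ := hψ.exists_fraction x
  have hm' := prod_pow_le_numerators (t.comp ψ) (RingHom.ker (s.comp ψ)) E _ a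
    (fun i ↦ sup_le_sup_right (le_inf (hM i) (hME i)) _) ν hm
  obtain ⟨n, ⟨hn, hn'⟩, _, hc, rfl⟩ := Submodule.mem_sup.mp hm'
  obtain ⟨c, rfl⟩ := Ideal.mem_span_singleton'.mp hc
  obtain ⟨d, hd, h⟩ := Ideal.mem_span_singleton_mul.mp (Ideal.mem_comap.mp hn')
  have hn : s (ψ n) = 0 := hn
  have hnzd {D : Type u} [CommRing D] (g : R →+* D) (hg : ∀ i, g (ψ (a i)) ∈ nonZeroDivisors D) :
      g (ψ (∏ i, a i ^ ν i)) ∈ nonZeroDivisors D := by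
    rw [map_prod, map_prod]
    refine Submonoid.prod_mem _ fun i _ ↦ ?_
    rw [map_pow, map_pow]
    exact pow_mem (hg i) _
  -- Under `s` the relation `a ^ ν * x = n + c * a ^ ν` becomes `0 = c * a ^ ν`, and `a ^ ν` is
  -- regular in `Q`.
  have hc : c ∈ RingHom.ker (s.comp ψ) := by
    have := congr(s $e)
    rw [map_mul, hx, mul_zero, map_add, map_add, hn, zero_add, map_mul, map_mul] at this
    exact (mul_right_mem_nonZeroDivisors_eq_zero_iff (hnzd s ha)).mp this.symm
  have hc' : t (ψ c) ∈ E := hE hc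
  have h' : t (ψ (∏ i, a i ^ ν i)) * d = t (ψ n) := h
  have : t (ψ (∏ i, a i ^ ν i)) * t x = t (ψ (∏ i, a i ^ ν i)) * (d + t (ψ c)) := by
    rw [← map_mul, e, map_add, map_add, mul_add, h', map_mul, map_mul, mul_comm (t (ψ c))]
  rw [Ideal.mem_comap, (mul_cancel_left_mem_nonZeroDivisors (hnzd t ha')).mp this]
  exact add_mem hd hc'

variable {X T Z : Scheme.{u}} {ι : Type v} [Fintype ι] {M J : ι → X.IdealSheafData}
  {hJ : ∀ i, IsLocallyPrincipal (J i)}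

/-- A bound for the pullback of the ideal of a closed subscheme of the dilatation which contains
no part of the exceptional divisors. -/
lemma ker_comap_le (σ : Z ⟶ dilatation M J hJ) [IsAffineHom σ]
    (hM : ∀ i, M i ≤ (σ ≫ dilatationMap M J hJ).ker)
    (hC : ∀ i, IsCartier ((J i).comap (σ ≫ dilatationMap M J hJ)))
    (t : T ⟶ dilatation M J hJ) (E : T.IdealSheafData)
    (hE : (σ ≫ dilatationMap M J hJ).ker.comap (t ≫ dilatationMap M J hJ) ≤ E)
    (hME : ∀ i, (M i).comap (t ≫ dilatationMap M J hJ) ≤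
      (J i).comap (t ≫ dilatationMap M J hJ) * E)
    (hC' : ∀ i, IsCartier ((J i).comap (t ≫ dilatationMap M J hJ))) : σ.ker.comap t ≤ E := by
  refine idealSheaf_le_of_local fun x ↦ ?_
  let q := t ≫ dilatationMap M J hJ
  obtain ⟨U, hxU, -, a, ha⟩ := exists_le_forall_principal hJ (q x) ⊤ trivial
  obtain ⟨W, hxW, -, hW⟩ := exists_affine_le_preimage q x ⊤ trivial U.1 hxU
  have hV : IsAffineOpen (dilatationMap M J hJ ⁻¹ᵁ U.1) := U.2.preimage _
  have hZ : IsAffineOpen ((σ ≫ dilatationMap M J hJ) ⁻¹ᵁ U.1) := U.2.preimage _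
  let V : (dilatation M J hJ).affineOpens := ⟨_, hV⟩
  have hWV : W.1 ≤ t ⁻¹ᵁ V.1 := hW
  refine ⟨W, hxW, ?_⟩
  rw [ideal_comap_eq_map_appLE t _ hWV, Ideal.map_le_iff_le_comap, Scheme.Hom.ker_apply]
  have et : q.appLE U.1 W.1 hW = (dilatationMap M J hJ).app U.1 ≫ t.appLE V.1 W.1 hWV :=
    Scheme.Hom.comp_appLE _ _ _ _ _
  have es : (σ ≫ dilatationMap M J hJ).app U.1 = (dilatationMap M J hJ).app U.1 ≫ σ.app V.1 :=
    Scheme.Hom.comp_app _ _ _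
  have hker : RingHom.ker ((σ.app V.1).hom.comp ((dilatationMap M J hJ).app U.1).hom) =
      (σ ≫ dilatationMap M J hJ).ker.ideal U := by
    rw [Scheme.Hom.ker_apply, es]
    rfl
  refine (isRingDilatation_app M J hJ U a ha).ker_le_comap (σ.app V.1).hom _ (E.ideal W)
    (fun i ↦ ?_) (fun i ↦ ?_) ?_ (fun i ↦ ?_) (fun i ↦ ?_)
  · rw [hker]; exact hM i U
  · have := (hC i).mem_nonZeroDivisors ⟨_, hZ⟩ (ideal_comap_eq_span _ le_rfl (ha i))
    rwa [Scheme.Hom.appLE_eq_app, es] at this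
  · rw [hker, ← Ideal.map_le_iff_le_comap, ← CommRingCat.hom_comp, ← et,
      ← ideal_comap_eq_map_appLE q _ hW]
    exact hE W
  · rw [← Ideal.map_le_iff_le_comap, ← CommRingCat.hom_comp, ← et,
      ← ideal_comap_eq_map_appLE q _ hW]
    have := hME i W
    rw [Scheme.IdealSheafData.ideal_mul, Pi.mul_apply, ideal_comap_eq_span q hW (ha i), et] at this
    exact this
  · have := (hC' i).mem_nonZeroDivisors W (ideal_comap_eq_span q hW (ha i))
    rwa [et] at this

/-- Locally an element of `M` is `c * a` with `J = (a)`. It vanishes on `Z`, where `a` is regular,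
so `c` already vanishes on `Z`. -/
lemma le_mul_ker {M J : X.IdealSheafData} (σ : Z ⟶ X) [IsAffineHom σ] (hMJ : M ≤ J)
    (hM : M ≤ σ.ker) (hJ : IsLocallyPrincipal J) (hC : IsCartier (J.comap σ)) :
    M ≤ J * σ.ker := by
  refine idealSheaf_le_of_local fun x ↦ ?_
  obtain ⟨U, hxU, -, a, ha⟩ := hJ.exists_le x ⊤ trivial
  refine ⟨U, hxU, fun m hm ↦ ?_⟩
  have hZ : IsAffineOpen (σ ⁻¹ᵁ U.1) := U.2.preimage _
  obtain ⟨c, rfl⟩ := Ideal.mem_span_singleton'.mp (ha ▸ hMJ U hm)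
  have h := hM U hm
  have hnzd := hC.mem_nonZeroDivisors ⟨_, hZ⟩ (ideal_comap_eq_span σ le_rfl ha)
  rw [Scheme.Hom.appLE_eq_app] at hnzd
  rw [Scheme.Hom.ker_apply, RingHom.mem_ker, map_mul] at h
  rw [Scheme.IdealSheafData.ideal_mul, Pi.mul_apply, ha, Scheme.Hom.ker_apply, mul_comm c]
  exact Ideal.mul_mem_mul (Ideal.mem_span_singleton_self _)
    ((mul_right_mem_nonZeroDivisors_eq_zero_iff hnzd).mp h)

end Kernel

/-! ### Deformation spaces -/

section DeformationSpace

variable {X T : Scheme.{u}}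

lemma idealSheaf_mul_le_left {J K : X.IdealSheafData} : J * K ≤ J := fun U ↦ by
  rw [Scheme.IdealSheafData.ideal_mul, Pi.mul_apply]
  exact Ideal.mul_le_left

lemma idealSheaf_mul_mono {J J' K K' : X.IdealSheafData} (h : J ≤ J') (h' : K ≤ K') :
    J * K ≤ J' * K' := fun U ↦ by
  rw [Scheme.IdealSheafData.ideal_mul, Scheme.IdealSheafData.ideal_mul, Pi.mul_apply, Pi.mul_apply]
  exact Ideal.mul_mono (h U) (h' U)

lemma comap_le_comap (f : T ⟶ X) {J K : X.IdealSheafData} (h : J ≤ K) : J.comap f ≤ K.comap f :=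
  Scheme.IdealSheafData.comap_mono f h

lemma comap_subschemeι_eq_bot {J K : X.IdealSheafData} (h : J ≤ K) :
    J.comap K.subschemeι = ⊥ := by
  rw [← le_bot_iff, ← Scheme.IdealSheafData.le_map_iff_comap_le, Scheme.IdealSheafData.map_bot,
    Scheme.IdealSheafData.ker_subschemeι]
  exact h

lemma isCartier_comap_prod {ι : Type v} {D : ι → X.IdealSheafData} {f : T ⟶ X}
    (hC : ∀ i, IsCartier ((D i).comap f)) (s : Finset ι) :
    IsCartier ((∏ i ∈ s, D i).comap f) := by
  rw [comap_prod]
  exact .prod s fun i _ ↦ hC i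

variable {I : Type v} [LinearOrder I] [Fintype I] {Y D : I → X.IdealSheafData} {hD : ∀ i, IsLocallyPrincipal (D i)}

instance : IsAffineHom (deformationMap Y D hD) := isAffineHom_dilatationMap _ _ _

lemma deformation_hom_ext {g g' : T ⟶ deformationSpace Y D hD}
    (h : g ≫ deformationMap Y D hD = g' ≫ deformationMap Y D hD)
    (hC : ∀ i, IsCartier ((D i).comap (g ≫ deformationMap Y D hD))) : g = g' :=
  dilatation_hom_ext h fun _ ↦ isCartier_comap_prod hC _

/-- The universal property of the deformation space. -/
lemma exists_deformation_lift (f : T ⟶ X) (hC : ∀ i, IsCartier ((D i).comap f))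
    (hY : ∀ i, (Y i).comap f ≤ (∏ j with i ≤ j, D j).comap f) :
    ∃ g : T ⟶ deformationSpace Y D hD, ∀ G, G ≫ deformationMap Y D hD = f ↔ G = g := by
  obtain ⟨g, hg⟩ := exists_dilatation_lift (M := Y) (J := fun i ↦ ∏ j with i ≤ j, D j)
    (hJ := fun _ ↦ .prod _ hD) f (fun _ ↦ isCartier_comap_prod hC _) hY
  refine ⟨g, fun G ↦ ⟨fun h ↦ deformation_hom_ext (h.trans hg.symm) fun i ↦ ?_, ?_⟩⟩
  · rw [h]; exact hC i
  · rintro rfl; exact hg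

/-- The dilatation makes `∏ j ≥ i, D j` Cartier, and `D i` is one of its factors. -/
lemma isCartier_comap_deformationMap (i : I) :
    IsCartier ((D i).comap (deformationMap Y D hD)) := by
  have h : IsCartier ((∏ j with i ≤ j, D j).comap (deformationMap Y D hD)) :=
    isCartier_comap_dilatationMap (M := Y) (hJ := fun i ↦ .prod {j | i ≤ j} hD) i
  rw [← Finset.mul_prod_erase _ _ (show i ∈ ({j | i ≤ j} : Finset I) by simp), comap_mul] at h
  exact h.of_mul_left ((hD i).comap _) ((IsLocallyPrincipal.prod _ hD).comap _)

lemma IsCartier.comap_deformationMap {K : X.IdealSheafData} (hK : IsCartier K) :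
    IsCartier (K.comap (deformationMap Y D hD)) :=
  IsCartier.comap_dilatationMap hK

lemma comap_deformationMap_le (i : I) :
    (Y i).comap (deformationMap Y D hD) ≤ (∏ j with i ≤ j, D j).comap (deformationMap Y D hD) :=
  comap_dilatationMap_le (M := Y) (hJ := fun i ↦ .prod {j | i ≤ j} hD) i

/-- The identity of `X` satisfies the lifting conditions, and by uniqueness its lift is inverse to
the deformation map. -/
lemma isIso_deformationMap (hY : ∀ i, Y i = ⊥) (hC : ∀ i, IsCartier (D i)) :
    IsIso (deformationMap Y D hD) := by
  obtain ⟨g, hg⟩ := exists_deformation_lift (Y := Y) (hD := hD) (𝟙 X)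
    (fun i ↦ by rw [Scheme.IdealSheafData.comap_id]; exact hC i)
    (fun i ↦ by rw [hY, Scheme.IdealSheafData.comap_bot]; exact bot_le)
  have hg' := (hg g).mpr rfl
  refine ⟨g, deformation_hom_ext ?_ fun i ↦ ?_, hg'⟩
  · rw [Category.assoc, hg', Category.comp_id, Category.id_comp]
  · rw [Category.assoc, hg', Category.comp_id]
    exact isCartier_comap_deformationMap i

section Order

variable {R : Type*} [CommMonoid R] (d : I → R) (S : Finset I)

/-- Nothing in `S` lies above `k`, so the divisor attached to `k` is the same in the iterated and in
the full space. -/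
lemma prod_compl_ge (hKS : ∀ k ∈ Sᶜ, ∀ s ∈ S, s < k) (k : ↥Sᶜ) : ∏ j : ↥Sᶜ with k ≤ j, d j = ∏ j with k.1 ≤ j, d j := by
  refine Finset.prod_bij (fun j _ ↦ j.1) (fun j hj ↦ by simpa using hj)
    (fun _ _ _ _ h ↦ Subtype.ext h) (fun j hj ↦ ?_) fun _ _ ↦ rfl
  have hj : k.1 ≤ j := by simpa using hj
  have : j ∈ Sᶜ := by
    by_contra h
    exact (hKS k k.2 j (by simpa using h)).not_ge hj
  exact ⟨⟨j, this⟩, Finset.mem_filter.mpr ⟨Finset.mem_univ _, hj⟩, rfl⟩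

/-- All of `Sᶜ` lies above `s`; the second factor is what the partial deformation space lacks at the
center `Y s`. -/
lemma prod_ge_eq_mul (hKS : ∀ k ∈ Sᶜ, ∀ s ∈ S, s < k) (s : S) :
    ∏ j with s.1 ≤ j, d j = (∏ j : S with s ≤ j, d j) * ∏ j : ↥Sᶜ, d j := by
  rw [Finset.prod_filter, Finset.prod_filter, ← Finset.prod_mul_prod_compl S]
  congr 1
  · exact (Finset.prod_coe_sort S fun j ↦ if s.1 ≤ j then d j else 1).symm
  · rw [Finset.prod_coe_sort Sᶜ d]
    exact Finset.prod_congr rfl fun j hj ↦ if_pos (hKS j hj s s.2).le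

end Order

end DeformationSpace

/-! ### Comparison of the iterated and the full deformation space -/

section Iterated

variable {X : Scheme.{u}} {I : Type v} [LinearOrder I]
  {Y D : I → X.IdealSheafData} {hD : ∀ i, IsLocallyPrincipal (D i)} {S : Finset I}

lemma comap_partialMap_le_ker {k : I} (σ : (Y k).subscheme ⟶ partialSpace Y D hD S)
    (hσ : σ ≫ partialMap Y D hD S = (Y k).subschemeι) :
    (Y k).comap (partialMap Y D hD S) ≤ σ.ker := by
  rw [← Scheme.IdealSheafData.le_map_iff_comap_le, ← Scheme.Hom.ker_comp, hσ,
    Scheme.IdealSheafData.ker_subschemeι]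

lemma isCartier_comap_partialMap (s : S) : IsCartier ((D s).comap (partialMap Y D hD S)) :=
  isCartier_comap_deformationMap (D := fun s : S ↦ D s) s

lemma comap_partialMap_le (s : S) : (Y s).comap (partialMap Y D hD S) ≤
    (∏ j : S with s ≤ j, D j).comap (partialMap Y D hD S) :=
  comap_deformationMap_le (Y := fun s : S ↦ Y s) (D := fun s : S ↦ D s) s

lemma partial_hom_ext {T : Scheme.{u}} {g g' : T ⟶ partialSpace Y D hD S}
    (h : g ≫ partialMap Y D hD S = g' ≫ partialMap Y D hD S)
    (hC : ∀ s : S, IsCartier ((D s).comap (g ≫ partialMap Y D hD S))) : g = g' :=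
  deformation_hom_ext (D := fun s : S ↦ D s) h hC

section Iteration

variable [Fintype I] (Z : ↥Sᶜ → (partialSpace Y D hD S).IdealSheafData)

/-- The dilatation map of `iteratedSpace` over the partial deformation space. -/
abbrev iterationMap : iteratedSpace Y D hD S Z ⟶ partialSpace Y D hD S :=
  deformationMap Z (fun k ↦ (D k).comap (partialMap Y D hD S)) fun k ↦ (hD k).comap _

lemma comap_iterationMap_le (hKS : ∀ k ∈ Sᶜ, ∀ s ∈ S, s < k) (k : ↥Sᶜ) :
    (Z k).comap (iterationMap Z) ≤
      (∏ j with k.1 ≤ j, D j).comap (iteratedMap Y D hD S Z) := by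
  have : (Z k).comap (iterationMap Z) ≤
      (∏ j : ↥Sᶜ with k ≤ j, (D j).comap (partialMap Y D hD S)).comap (iterationMap Z) :=
    comap_deformationMap_le k
  rwa [← comap_prod (partialMap Y D hD S) _ (fun j : ↥Sᶜ ↦ D j),
    ← Scheme.IdealSheafData.comap_comp, prod_compl_ge D S hKS] at this

/-- For `i ∈ S` the first dilatation makes `D i` Cartier and the second preserves this; for the
other indices the second dilatation does it. -/
lemma isCartier_comap_iteratedMap (i : I) :
    IsCartier ((D i).comap (iteratedMap Y D hD S Z)) := by
  rw [Scheme.IdealSheafData.comap_comp]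
  by_cases hi : i ∈ S
  · exact (isCartier_comap_partialMap ⟨i, hi⟩).comap_deformationMap
  · exact isCartier_comap_deformationMap
      (D := fun k : ↥Sᶜ ↦ (D k).comap (partialMap Y D hD S)) ⟨i, Finset.mem_compl.mpr hi⟩

end Iteration

variable [Fintype I] (hY : Monotone Y) (hYD : ∀ i j, IsCartier ((D j).comap (Y i).subschemeι))
  (hKS : ∀ k ∈ Sᶜ, ∀ s ∈ S, s < k)
  (σ : ∀ k : ↥Sᶜ, (Y k).subscheme ⟶ partialSpace Y D hD S)
  (hσ : ∀ k, σ k ≫ partialMap Y D hD S = (Y k).subschemeι) [∀ k, IsClosedImmersion (σ k)]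

include hY hYD hKS hσ

lemma comap_partialMap_le_mul_ker (s : S) (k : ↥Sᶜ) : (Y s).comap (partialMap Y D hD S) ≤
    (∏ j : S with s ≤ j, D j).comap (partialMap Y D hD S) * (σ k).ker := by
  refine le_mul_ker (σ k) (comap_partialMap_le s) ?_
    ((IsLocallyPrincipal.prod {j : S | s ≤ j} (J := fun s : S ↦ D s) fun s ↦ hD s).comap _) ?_
  · exact (comap_le_comap _ (hY (hKS k k.2 s s.2).le)).trans (comap_partialMap_le_ker _ (hσ k))
  · rw [← Scheme.IdealSheafData.comap_comp, hσ]
    exact isCartier_comap_prod (D := fun s : S ↦ D s) (fun s ↦ hYD k s) _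

lemma comap_iteratedMap_le (i : I) :
    (Y i).comap (iteratedMap Y D hD S fun k ↦ (σ k).ker) ≤
      (∏ j with i ≤ j, D j).comap (iteratedMap Y D hD S fun k ↦ (σ k).ker) := by
  by_cases hi : i ∈ S
  · lift i to S using hi
    rw [prod_ge_eq_mul D S hKS, comap_mul, Scheme.IdealSheafData.comap_comp]
    rcases (Sᶜ).eq_empty_or_nonempty with h | h
    · have : IsEmpty ↥Sᶜ := Finset.isEmpty_coe_sort.mpr h
      rw [show ∏ j : ↥Sᶜ, D j = 1 from Fintype.prod_empty _,
        show (1 : X.IdealSheafData).comap (iteratedMap Y D hD S fun k ↦ (σ k).ker) = 1 from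
          Scheme.IdealSheafData.comap_top _, mul_one, Scheme.IdealSheafData.comap_comp]
      exact comap_le_comap _ (comap_partialMap_le i)
    -- The least `k` is chosen so that the bound on `(σ k).ker` is the product over all of `Sᶜ`.
    · let k : ↥Sᶜ := ⟨(Sᶜ).min' h, Finset.min'_mem _ h⟩
      refine (comap_le_comap _ (comap_partialMap_le_mul_ker hY hYD hKS σ hσ i k)).trans ?_
      rw [comap_mul, ← Scheme.IdealSheafData.comap_comp]
      refine idealSheaf_mul_mono le_rfl ?_
      have hk : (Finset.univ : Finset ↥Sᶜ) = ({j : ↥Sᶜ | k ≤ j} : Finset ↥Sᶜ) :=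
        (Finset.filter_true_of_mem fun (j : ↥Sᶜ) _ ↦ Finset.min'_le _ _ j.2).symm
      rw [hk, prod_compl_ge D S hKS]
      exact comap_iterationMap_le _ hKS k
  · refine le_trans ?_ (comap_iterationMap_le _ hKS ⟨i, Finset.mem_compl.mpr hi⟩)
    rw [Scheme.IdealSheafData.comap_comp]
    exact comap_le_comap _ (comap_partialMap_le_ker _ (hσ ⟨i, Finset.mem_compl.mpr hi⟩))

/-- Instance of `ker_comap_le` with `E` the pullback of `∏ j ≥ k, D j`: on the full space `Y k` lies
in `E`, and `Y s` lies in its partial divisor times `E`. -/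
lemma comap_ker_le_of_lift (t : deformationSpace Y D hD ⟶ partialSpace Y D hD S)
    (ht : t ≫ partialMap Y D hD S = deformationMap Y D hD) (k : ↥Sᶜ) :
    (σ k).ker.comap t ≤ (∏ j : ↥Sᶜ with k ≤ j, D j).comap (deformationMap Y D hD) := by
  have hker : (σ k ≫ partialMap Y D hD S).ker = Y k := by
    rw [hσ, Scheme.IdealSheafData.ker_subschemeι]
  have haff : IsAffineHom (σ k) := inferInstance
  refine @ker_comap_le _ _ _ _ _ (fun s : S ↦ Y s) (fun s : S ↦ ∏ j : S with s ≤ j, D j)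
    (fun s ↦ .prod {j : S | s ≤ j} fun s ↦ hD s) (σ k) haff (fun s ↦ ?_) (fun s ↦ ?_) t _ ?_ (fun s ↦ ?_) (fun s ↦ ?_)
  · exact (hY (hKS k k.2 s s.2).le).trans hker.ge
  · exact isCartier_comap_prod (D := fun s : S ↦ D s) (fun s ↦ (hσ k).symm ▸ hYD k s) _
  · change (σ k ≫ partialMap Y D hD S).ker.comap (t ≫ partialMap Y D hD S) ≤ _
    rw [hker, ht, prod_compl_ge D S hKS]
    exact comap_deformationMap_le k.1
  · change (Y s).comap (t ≫ partialMap Y D hD S) ≤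
      (∏ j : S with s ≤ j, D j).comap (t ≫ partialMap Y D hD S) * _
    rw [ht, ← comap_mul]
    refine (comap_deformationMap_le s.1).trans (comap_le_comap _ ?_)
    rw [prod_ge_eq_mul D S hKS]
    refine idealSheaf_mul_mono le_rfl ?_
    -- The factors with `j < k` are not part of `E` and may be dropped.
    rw [← Finset.prod_filter_mul_prod_filter_not Finset.univ (fun j : ↥Sᶜ ↦ k ≤ j)]
    exact idealSheaf_mul_le_left
  · exact isCartier_comap_prod (D := fun s : S ↦ D s)
      (fun s ↦ ht.symm ▸ isCartier_comap_deformationMap s.1) _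

/-- Two successive lifts: first to the partial space, whose divisors divide those of the full space,
then to its dilatation along the `σ k`. -/
lemma exists_inverse_lift : ∃ Ψ : deformationSpace Y D hD ⟶
    iteratedSpace Y D hD S (fun k ↦ (σ k).ker),
      Ψ ≫ iteratedMap Y D hD S (fun k ↦ (σ k).ker) = deformationMap Y D hD := by
  obtain ⟨t, ht⟩ := exists_deformation_lift (Y := fun s : S ↦ Y s) (D := fun s : S ↦ D s)
    (hD := fun s ↦ hD s) (deformationMap Y D hD) (fun s ↦ isCartier_comap_deformationMap s.1)
    fun s ↦ by
      refine (comap_deformationMap_le s.1).trans (comap_le_comap _ ?_)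
      rw [prod_ge_eq_mul D S hKS]
      exact idealSheaf_mul_le_left
  replace ht : t ≫ partialMap Y D hD S = deformationMap Y D hD := (ht t).mpr rfl
  obtain ⟨Ψ, hΨ⟩ := exists_deformation_lift (Y := fun k ↦ (σ k).ker)
    (D := fun k : ↥Sᶜ ↦ (D k).comap (partialMap Y D hD S)) (hD := fun k ↦ (hD k).comap _) t
    (fun k ↦ by
      rw [← Scheme.IdealSheafData.comap_comp, ht]
      exact isCartier_comap_deformationMap k.1) fun k ↦ by
    rw [← comap_prod (partialMap Y D hD S) _ (fun j : ↥Sᶜ ↦ D j),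
      ← Scheme.IdealSheafData.comap_comp, ht]
    exact comap_ker_le_of_lift hY hYD hKS σ hσ t ht k
  replace hΨ : Ψ ≫ iterationMap (fun k ↦ (σ k).ker) = t := (hΨ Ψ).mpr rfl
  exact ⟨Ψ, by rw [← Category.assoc, hΨ, ht]⟩

/-- A further deformation of a partial deformation space along sections over the remaining centers
is the full deformation space. -/
theorem exists_iso_iteratedSpace (Z : ↥Sᶜ → (partialSpace Y D hD S).IdealSheafData)
    (hZ : ∀ k, Z k = (σ k).ker) :
    ∃ Θ : iteratedSpace Y D hD S Z ⟶ deformationSpace Y D hD,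
      (∀ G, G ≫ deformationMap Y D hD = iteratedMap Y D hD S Z ↔ G = Θ) ∧ IsIso Θ := by
  obtain rfl : Z = fun k ↦ (σ k).ker := funext hZ
  obtain ⟨Θ, hΘ⟩ := exists_deformation_lift (Y := Y) (hD := hD) _
    (isCartier_comap_iteratedMap fun k ↦ (σ k).ker) (comap_iteratedMap_le hY hYD hKS σ hσ)
  obtain ⟨Ψ, hΨ⟩ := exists_inverse_lift hY hYD hKS σ hσ
  have hΘ' := (hΘ Θ).mpr rfl
  refine ⟨Θ, hΘ, Ψ, ?_, ?_⟩
  · have h : (Θ ≫ Ψ) ≫ iteratedMap Y D hD S _ = iteratedMap Y D hD S _ := by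
      rw [Category.assoc, hΨ, hΘ']
    -- Uniqueness goes in two stages: equality over `X` gives equality over `P` since the `D s` are
    -- Cartier, and the `D k` then give equality in the iterated space.
    have h' : (Θ ≫ Ψ) ≫ iterationMap _ = iterationMap _ := by
      refine partial_hom_ext ((Category.assoc _ _ _).trans h) fun s ↦ ?_
      rw [Category.assoc, h]
      exact isCartier_comap_iteratedMap _ s.1
    refine deformation_hom_ext (h'.trans (Category.id_comp _).symm) fun k ↦ ?_
    rw [h', ← Scheme.IdealSheafData.comap_comp]
    exact isCartier_comap_iteratedMap _ k.1
  · have h : (Ψ ≫ Θ) ≫ deformationMap Y D hD = deformationMap Y D hD := by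
      rw [Category.assoc, hΘ', hΨ]
    refine deformation_hom_ext (h.trans (Category.id_comp _).symm) fun i ↦ ?_
    rw [h]
    exact isCartier_comap_deformationMap i

end Iterated

end MultiCenter

end

/-! ### The main theorem -/

theorem mainTheorem7 {X : Scheme.{u}} {I : Type v} [LinearOrder I] [Fintype I]
    (Y D : I → X.IdealSheafData) (hY : Monotone Y) (hD : ∀ i, IsLocallyPrincipal (D i))
    (hYD : ∀ i j, IsCartier ((D j).comap (Y i).subschemeι))
    (S : Finset I) (hKS : ∀ k ∈ Sᶜ, ∀ s ∈ S, s < k) :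
    ∃ F : ∀ k : ↥Sᶜ, centerSpace Y D hD S k ⟶ partialSpace Y D hD S,
      (∀ (k : ↥Sᶜ) (G : centerSpace Y D hD S k ⟶ partialSpace Y D hD S),
        G ≫ partialMap Y D hD S = centerMap Y D hD S k ≫ (Y k).subschemeι ↔ G = F k) ∧
      (∀ k, IsClosedImmersion (F k)) ∧
      Monotone (fun k ↦ (F k).ker) ∧
      (∃ Θ : iteratedSpace Y D hD S (fun k ↦ (F k).ker) ⟶ deformationSpace Y D hD,
        (∀ G, G ≫ deformationMap Y D hD = iteratedMap Y D hD S _ ↔ G = Θ) ∧ IsIso Θ) ∧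
      (∀ k : ↥Sᶜ, IsIso (centerMap Y D hD S k)) ∧
      ∃ σ : ∀ k : ↥Sᶜ, (Y k).subscheme ⟶ partialSpace Y D hD S,
        (∀ (k : ↥Sᶜ) (G : (Y k).subscheme ⟶ partialSpace Y D hD S),
          G ≫ partialMap Y D hD S = (Y k).subschemeι ↔ G = σ k) ∧
        (∀ k, IsClosedImmersion (σ k)) ∧
        (∀ k : ↥Sᶜ, centerMap Y D hD S k ≫ σ k = F k) ∧
        (∀ k, (σ k).ker = (F k).ker) ∧
        ∃ Θ' : iteratedSpace Y D hD S (fun k ↦ (σ k).ker) ⟶ deformationSpace Y D hD,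
          (∀ G, G ≫ deformationMap Y D hD = iteratedMap Y D hD S _ ↔ G = Θ') ∧ IsIso Θ' := by
  have hbot (s : S) (k : ↥Sᶜ) : (Y s).comap (Y k).subschemeι = ⊥ :=
    comap_subschemeι_eq_bot (hY (hKS k k.2 s s.2).le)
  have hiso (k : ↥Sᶜ) : IsIso (centerMap Y D hD S k) :=
    isIso_deformationMap (fun s ↦ hbot s k) fun s ↦ hYD k s
  have hlift (k : ↥Sᶜ) := exists_deformation_lift (Y := fun s : S ↦ Y s) (D := fun s : S ↦ D s)
    (hD := fun s ↦ hD s) (Y k).subschemeι (fun s ↦ hYD k s) fun s ↦ (hbot s k).trans_le bot_le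
  choose σ hσ using hlift
  have hσ' (k : ↥Sᶜ) : σ k ≫ partialMap Y D hD S = (Y k).subschemeι := (hσ k _).mpr rfl
  have hclosed (k : ↥Sᶜ) : IsClosedImmersion (σ k) := by
    have : IsClosedImmersion (σ k ≫ partialMap Y D hD S) := hσ' k ▸ inferInstance
    -- The map to `X` is affine, hence separated, so a lift of a closed immersion is one.
    exact IsClosedImmersion.of_comp _ (partialMap Y D hD S)
  have hker (k : ↥Sᶜ) : (centerMap Y D hD S k ≫ σ k).ker = (σ k).ker :=
    Scheme.Hom.ker_comp_of_isIso _ _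
  refine ⟨fun k ↦ centerMap Y D hD S k ≫ σ k, fun k G ↦ ?_, fun k ↦ inferInstance, fun k k' h ↦ ?_,
    exists_iso_iteratedSpace hY hYD hKS σ hσ' _ hker, hiso, σ, hσ, hclosed, fun _ ↦ rfl,
    fun k ↦ (hker k).symm, exists_iso_iteratedSpace hY hYD hKS σ hσ' _ fun _ ↦ rfl⟩
  -- Moving the isomorphism `centerMap` across turns uniqueness of `F k` into uniqueness of `σ k`.
  · rw [← IsIso.inv_comp_eq, ← IsIso.inv_comp_eq, ← hσ, Category.assoc]
  -- By uniqueness the section over the smaller center is the restriction of the one over the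
  -- larger, so its kernel is larger.
  · have e : Scheme.IdealSheafData.inclusion (hY h) ≫ σ k = σ k' := by
      rw [← hσ]
      exact (Category.assoc _ _ _).trans ((congrArg (_ ≫ ·) (hσ' k)).trans
        (Scheme.IdealSheafData.inclusion_subschemeι _))
    change (centerMap Y D hD S k ≫ σ k).ker ≤ (centerMap Y D hD S k' ≫ σ k').ker
    rw [hker, hker, ← e]
    exact Scheme.Hom.le_ker_comp _ _
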